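/- **Setting.** Let $\mathrm{fHilb}$ be the category of finite-dimensional complex Hilbert spaces and linear maps. For linear $f:H\to K$ write $\widehat f(\rho)=f\rho f^\dagger$ for its doubling, a linear map from operators on $H$ to operators on $K$. * $\mathrm{CPM}(\mathrm{fHilb})$ is the monoidal category whose objects are finite-dimensional Hilbert spaces and whose morphisms $H\to K$ are the completely positive maps, i.e. the maps $\operatorname{tr}_E\circ\widehat f$ with $f:H\to K\otimes E$ linear. * A *classical structure* $Z$ on $G$ is a special commutative $\dagger$-Frobenius algebra on $G$ in $\mathrm{fHilb}$, with multiplication $\mu:G\otimes G\to G$, unit $\eta\in G$, comultiplication $\delta=\mu^\dagger$ and counit $\eta^\dagger$. Its *bridge* is the functional $\eta^\dagger\mu:G\otimes G\to\mathbb C$. * $\mathrm{DD}(\mathrm{fHilb})$ is the monoidal category of density hypercubes. Its objects are $\mathrm{DD}(H)$ for $H$ in $\mathrm{fHilb}$. A morphism $\mathrm{DD}(H)\to\mathrm{DD}(K)$ is a linear map from operators on $H\otimes H$ to operators on $K\otimes K$ obtained as follows, for some $E$, $G$, some classical structure on $G$ and some linear $f:H\to G\otimes K\otimes E$: take two copies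 of $\widehat f$, join their two outputs $G$ by the doubled bridge, and discard both outputs $E$ by the trace. Composition is composition of maps. The tensor product is $\mathrm{DD}(H)\otimes\mathrm{DD}(K)=\mathrm{DD}(H\otimes K)$, with the interchange $(H\otimes H)\otimes(K\otimes K)\cong(H\otimes K)\otimes(H\otimes K)$ used on morphisms. The discarding map $\operatorname{tr}_{\mathrm{DD}(H)}$ is $\rho\mapsto\operatorname{tr}\rho$ for operators $\rho$ on $H\otimes H$. * The *hyper-decoherence map* of a classical structure $Z$ on $H$ is the idempotent $\mathrm{hyp}_Z:=\widehat{\delta\mu}:\mathrm{DD}(H)\to\mathrm{DD}(H)$. * The Karoubi envelope of a category has as objects the pairs $(X,p)$ with $p:X\to X$ idempotent, and as morphisms $(X,p)\to(Y,q)$ the morphisms $f:X\to Y$ with $q f p=f$. The Karoubi envelope of a monoidal category is monoidal, with $(X,p)\otimes(Y,q)=(X\otimes Y,p\otimes q)$. Let $\mathrm{Kar}(\mathrm{DD}(\mathrm{fHilb}))_Q$ be the full subcategory of the Karoubi envelope of $\mathrm{DD}(\mathrm{fHilb})$ on the objects of the form $(\mathrm{DD}(H),\mathrm{hyp}_Z)$;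 it is closed under tensor products and contains the tensor unit. In all these categories, sums and multiples by scalars in $\mathbb R^+=[0,\infty)$ of morphisms are formed pointwise. **Proposition.** There is an $\mathbb R^+$-linear monoidal equivalence of categories between $\mathrm{Kar}(\mathrm{DD}(\mathrm{fHilb}))_Q$ and $\mathrm{CPM}(\mathrm{fHilb})$ under which the trace-preserving CP maps correspond exactly to the normalised maps. Here a map $f:(\mathrm{DD}(H),\mathrm{hyp}_Z)\to(\mathrm{DD}(K),\mathrm{hyp}_W)$ is *normalised* if $\operatorname{tr}_{(\mathrm{DD}(K),\mathrm{hyp}_W)}\circ f=\operatorname{tr}_{(\mathrm{DD}(H),\mathrm{hyp}_Z)}$, for the discarding maps $\operatorname{tr}_{(\mathrm{DD}(H),\mathrm{hyp}_Z)}:=\operatorname{tr}_{\mathrm{DD}(H)}\circ\mathrm{hyp}_Z$. Moreover, for every $H$ and every classical structure $Z$ on $H$ with multiplication $\mu$, this discarding map is the "tree-on-a-bridge" effect, the doubled multiplication followed by the discarding of its output: $$\operatorname{tr}_{(\mathrm{DD}(H),\mathrm{hyp}_Z)}(\rho)=\operatorname{tr}_H(\mu\,\rho\,\mu^\dagger).$$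 -/

import Mathlib

open CategoryTheory MonoidalCategory
open scoped NNReal

set_option linter.unusedSectionVars false
set_option linter.unusedVariables false

noncomputable section

/-- A finite-dimensional complex Hilbert space. -/
structure FdHilb where
  of ::
  carrier : Type
  [instNACG : NormedAddCommGroup carrier]
  [instIPS : InnerProductSpace ℂ carrier]
  [instFD : FiniteDimensional ℂ carrier]

namespace FdHilb

instance : CoeSort FdHilb Type := ⟨FdHilb.carrier⟩

attribute [instance] FdHilb.instNACG FdHilb.instIPS FdHilb.instFD

/-- The tensor product of Hilbert spaces. -/
def tensor (H K : FdHilb) : FdHilb := FdHilb.of (TensorProduct ℂ H K)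

/-- The one-dimensional Hilbert space `ℂ`. -/
def unit : FdHilb := FdHilb.of ℂ

end FdHilb

infixl:100 " ⊗ʰ " => FdHilb.tensor

namespace Hyp

variable {A B C D E G H K L G' H' K' L' : FdHilb}
variable {M : Type} [AddCommMonoid M] [Module ℂ M]

/-! ### Multilinear algebra of finite-dimensional Hilbert spaces -/

/-- The pure tensor `x ⊗ y`, as a bilinear map. -/
def tm (H K : FdHilb) : H →ₗ[ℂ] K →ₗ[ℂ] H ⊗ʰ K := TensorProduct.mk ℂ H K

notation:100 x:100 " ⊗ᵗ " y:101 => Hyp.tm _ _ x y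

/-- The tensor product of linear maps. -/
def map (f : H →ₗ[ℂ] K) (g : H' →ₗ[ℂ] K') : H ⊗ʰ H' →ₗ[ℂ] K ⊗ʰ K' := TensorProduct.map f g

/-- The associator `(A ⊗ B) ⊗ C → A ⊗ (B ⊗ C)`. -/
def assoc (A B C : FdHilb) : (A ⊗ʰ B) ⊗ʰ C →ₗ[ℂ] A ⊗ʰ (B ⊗ʰ C) :=
  (TensorProduct.assoc ℂ A B C).toLinearMap

/-- The inverse associator `A ⊗ (B ⊗ C) → (A ⊗ B) ⊗ C`. -/
def assocInv (A B C : FdHilb) : A ⊗ʰ (B ⊗ʰ C) →ₗ[ℂ] (A ⊗ʰ B) ⊗ʰ C :=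
  (TensorProduct.assoc ℂ A B C).symm.toLinearMap

/-- The interchange `(A ⊗ B) ⊗ (C ⊗ D) → (A ⊗ C) ⊗ (B ⊗ D)` of the two middle factors. -/
def swapMid (A B C D : FdHilb) : (A ⊗ʰ B) ⊗ʰ (C ⊗ʰ D) →ₗ[ℂ] (A ⊗ʰ C) ⊗ʰ (B ⊗ʰ D) :=
  (TensorProduct.tensorTensorTensorComm ℂ A B C D).toLinearMap

/-- The identification of the one-dimensional Hilbert space with `ℂ`. -/
def scal : FdHilb.unit →ₗ[ℂ] ℂ := LinearMap.id

/-- The vector `1` of the one-dimensional Hilbert space. -/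
def one : FdHilb.unit := (1 : ℂ)

/-- The left unitor `ℂ ⊗ H → H`. -/
def lid (H : FdHilb) : FdHilb.unit ⊗ʰ H →ₗ[ℂ] H := (TensorProduct.lid ℂ H).toLinearMap

/-- The right unitor `H ⊗ ℂ → H`. -/
def rid (H : FdHilb) : H ⊗ʰ FdHilb.unit →ₗ[ℂ] H := (TensorProduct.rid ℂ H).toLinearMap

/-- The linear map `G ⊗ K → K` applying a linear functional to the first factor. -/
def applyFst (φ : G →ₗ[ℂ] ℂ) (K : FdHilb) : G ⊗ʰ K →ₗ[ℂ] K :=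
  (TensorProduct.lid ℂ K).toLinearMap ∘ₗ LinearMap.rTensor K φ

/-- The adjoint `f†` of a linear map between finite-dimensional Hilbert spaces. -/
def dag (f : H →ₗ[ℂ] K) : K →ₗ[ℂ] H := LinearMap.adjoint f

theorem hext {f g : H ⊗ʰ K →ₗ[ℂ] M} (h : ∀ x y, f (x ⊗ᵗ y) = g (x ⊗ᵗ y)) : f = g :=
  TensorProduct.ext' h

theorem hext_l {f g : (A ⊗ʰ B) ⊗ʰ C →ₗ[ℂ] M}
    (h : ∀ x y z, f ((x ⊗ᵗ y) ⊗ᵗ z) = g ((x ⊗ᵗ y) ⊗ᵗ z)) : f = g := by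
  refine hext fun x z => ?_
  have : f ∘ₗ (tm _ _).flip z = g ∘ₗ (tm _ _).flip z := hext fun x y => h x y z
  exact LinearMap.congr_fun this x

theorem hext_r {f g : A ⊗ʰ (B ⊗ʰ C) →ₗ[ℂ] M}
    (h : ∀ x y z, f (x ⊗ᵗ (y ⊗ᵗ z)) = g (x ⊗ᵗ (y ⊗ᵗ z))) : f = g := by
  refine hext fun x z => ?_
  have : f ∘ₗ tm _ _ x = g ∘ₗ tm _ _ x := hext fun y z => h x y z
  exact LinearMap.congr_fun this z

theorem hext4 {f g : (A ⊗ʰ B) ⊗ʰ (C ⊗ʰ D) →ₗ[ℂ] M}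
    (h : ∀ x y z w, f ((x ⊗ᵗ y) ⊗ᵗ (z ⊗ᵗ w)) = g ((x ⊗ᵗ y) ⊗ᵗ (z ⊗ᵗ w))) : f = g := by
  refine hext_l fun x y z => ?_
  have : f ∘ₗ tm _ _ (x ⊗ᵗ y) = g ∘ₗ tm _ _ (x ⊗ᵗ y) := hext fun z w => h x y z w
  exact LinearMap.congr_fun this z

theorem hext6 {f g : (A ⊗ʰ (B ⊗ʰ C)) ⊗ʰ (D ⊗ʰ (E ⊗ʰ G)) →ₗ[ℂ] M}
    (h : ∀ a b c d e x, f ((a ⊗ᵗ (b ⊗ᵗ c)) ⊗ᵗ (d ⊗ᵗ (e ⊗ᵗ x))) =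
      g ((a ⊗ᵗ (b ⊗ᵗ c)) ⊗ᵗ (d ⊗ᵗ (e ⊗ᵗ x)))) : f = g := by
  refine hext fun s t => ?_
  have h1 : ∀ a b c, f ∘ₗ tm _ _ (a ⊗ᵗ (b ⊗ᵗ c)) = g ∘ₗ tm _ _ (a ⊗ᵗ (b ⊗ᵗ c)) :=
    fun a b c => hext_r fun d e x => h a b c d e x
  have h2 : f ∘ₗ (tm _ _).flip t = g ∘ₗ (tm _ _).flip t :=
    hext_r fun a b c => LinearMap.congr_fun (h1 a b c) t
  exact LinearMap.congr_fun h2 s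

@[simp] theorem map_tm (f : H →ₗ[ℂ] K) (g : H' →ₗ[ℂ] K') (x : H) (y : H') :
    map f g (tm _ _ x y) = tm _ _ (f x) (g y) := rfl

@[simp] theorem assoc_tm (x : A) (y : B) (z : C) :
    assoc A B C (tm _ _ (tm _ _ x y) z) = tm _ _ x (tm _ _ y z) := rfl

@[simp] theorem assocInv_tm (x : A) (y : B) (z : C) :
    assocInv A B C (tm _ _ x (tm _ _ y z)) = tm _ _ (tm _ _ x y) z := rfl

@[simp] theorem swapMid_tm (x : A) (y : B) (z : C) (w : D) :
    swapMid A B C D (tm _ _ (tm _ _ x y) (tm _ _ z w)) =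
      tm _ _ (tm _ _ x z) (tm _ _ y w) := rfl

@[simp] theorem lid_tm (c : FdHilb.unit) (x : H) : lid H (tm _ _ c x) = scal c • x := rfl

@[simp] theorem rid_tm (c : FdHilb.unit) (x : H) : rid H (tm _ _ x c) = scal c • x := rfl

@[simp] theorem scal_one : scal one = 1 := rfl

@[simp] theorem inner_unit (c d : FdHilb.unit) : inner ℂ c d = scal d * star (scal c) := rfl

theorem scal_inj {c d : FdHilb.unit} (h : scal c = scal d) : c = d := h

theorem eq_scal_smul (c : FdHilb.unit) : c = scal c • one := scal_inj (by simp)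

@[simp] theorem applyFst_tm (φ : G →ₗ[ℂ] ℂ) (x : G) (y : K) :
    applyFst φ K (tm _ _ x y) = φ x • y := rfl

@[simp] theorem inner_tm (x x' : H) (y y' : K) :
    inner ℂ (tm _ _ x y) (tm _ _ x' y') = inner ℂ x x' * inner ℂ y y' :=
  TensorProduct.inner_tmul (𝕜 := ℂ) x x' y y'

theorem map_comp (f : H →ₗ[ℂ] K) (g : H' →ₗ[ℂ] K') (f' : K →ₗ[ℂ] L) (g' : K' →ₗ[ℂ] L') :
    map (f' ∘ₗ f) (g' ∘ₗ g) = map f' g' ∘ₗ map f g := hext fun _ _ => rfl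

@[simp] theorem map_id : map (LinearMap.id : H →ₗ[ℂ] H) (LinearMap.id : K →ₗ[ℂ] K) =
    LinearMap.id := hext fun _ _ => rfl

theorem tensor_induction {p : H ⊗ʰ K → Prop} (t : H ⊗ʰ K) (h0 : p 0)
    (ht : ∀ x y, p (tm _ _ x y)) (ha : ∀ a b, p a → p b → p (a + b)) : p t :=
  TensorProduct.induction_on t h0 ht ha

theorem swapMid_swapMid (A B C D : FdHilb) :
    swapMid A C B D ∘ₗ swapMid A B C D = LinearMap.id := hext4 fun _ _ _ _ => rfl

theorem dag_inner_right (f : H →ₗ[ℂ] K) (x : H) (y : K) :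
    inner ℂ x (dag f y) = inner ℂ (f x) y := LinearMap.adjoint_inner_right f x y

theorem dag_inner_left (f : H →ₗ[ℂ] K) (x : H) (y : K) :
    inner ℂ (dag f y) x = inner ℂ y (f x) := LinearMap.adjoint_inner_left f x y

theorem dag_comp (g : K →ₗ[ℂ] L) (f : H →ₗ[ℂ] K) : dag (g ∘ₗ f) = dag f ∘ₗ dag g :=
  LinearMap.adjoint_comp g f

@[simp] theorem dag_dag (f : H →ₗ[ℂ] K) : dag (dag f) = f := LinearMap.adjoint_adjoint f

@[simp] theorem dag_id : dag (LinearMap.id : H →ₗ[ℂ] H) = LinearMap.id := LinearMap.adjoint_id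

@[simp] theorem dag_smul (c : ℂ) (f : H →ₗ[ℂ] K) : dag (c • f) = star c • dag f :=
  map_smulₛₗ LinearMap.adjoint c f

@[simp] theorem dag_map (f : H →ₗ[ℂ] K) (g : H' →ₗ[ℂ] K') :
    dag (map f g) = map (dag f) (dag g) := TensorProduct.adjoint_map f g

/-- Vectors with the same inner products are equal. -/
theorem vec_ext {x y : H} (h : innerₛₗ ℂ x = innerₛₗ ℂ y) : x = y :=
  ext_inner_right ℂ fun v => LinearMap.congr_fun h v

theorem dag_swapMid (A B C D : FdHilb) : dag (swapMid A B C D) = swapMid A C B D := by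
  refine hext4 fun a c b d => vec_ext (hext4 fun a' b' c' d' => ?_)
  simp only [innerₛₗ_apply_apply, dag_inner_left, swapMid_tm, inner_tm]
  ring

theorem dag_assoc (A B C : FdHilb) : dag (assoc A B C) = assocInv A B C := by
  refine hext_r fun a b c => vec_ext (hext_l fun a' b' c' => ?_)
  simp only [innerₛₗ_apply_apply, dag_inner_left, assoc_tm, assocInv_tm, inner_tm]
  ring

theorem dag_assocInv (A B C : FdHilb) : dag (assocInv A B C) = assoc A B C := by
  rw [← dag_assoc, dag_dag]

theorem dag_lid_apply (x : H) : dag (lid H) x = tm _ _ one x := by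
  refine vec_ext (hext fun a' b' => ?_)
  simp [dag_inner_left]

theorem dag_rid_apply (x : H) : dag (rid H) x = tm _ _ x one := by
  refine vec_ext (hext fun a' b' => ?_)
  simp [dag_inner_left, mul_comm]

theorem dag_applyFst (v : G) (x : K) : dag (applyFst (innerₛₗ ℂ v) K) x = tm _ _ v x := by
  refine vec_ext (hext fun a' b' => ?_)
  simp [dag_inner_left]

/-! ### Completely positive maps -/

/-- The space of linear operators on `H`; it plays the role of the doubled system `H* ⊗ H`. -/
abbrev Op (H : FdHilb) : Type := H →ₗ[ℂ] H

/-- The doubled map `f* ⊗ f` of a linear map `f : H → K`, acting on operators as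
`ρ ↦ f ∘ ρ ∘ f†`. -/
def doubled (f : H →ₗ[ℂ] K) : Op H →ₗ[ℂ] Op K where
  toFun ρ := f ∘ₗ ρ ∘ₗ dag f
  map_add' ρ σ := by rw [LinearMap.add_comp, LinearMap.comp_add]
  map_smul' c ρ := by rw [LinearMap.smul_comp, LinearMap.comp_smul]; rfl

/-- The linear isomorphism `Op H ⊗ Op K ≃ Op (H ⊗ K)`. -/
def opEquiv (H K : FdHilb) : TensorProduct ℂ (Op H) (Op K) ≃ₗ[ℂ] Op (H ⊗ʰ K) :=
  homTensorHomEquiv ℂ H K H K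

/-- The tensor product of two linear maps between operator spaces: the linear map with
`A ⊗ B ↦ Φ A ⊗ Ψ B`. -/
def opTensor (Φ : Op H →ₗ[ℂ] Op K) (Ψ : Op H' →ₗ[ℂ] Op K') : Op (H ⊗ʰ H') →ₗ[ℂ] Op (K ⊗ʰ K') :=
  (opEquiv K K').toLinearMap ∘ₗ TensorProduct.map Φ Ψ ∘ₗ (opEquiv H H').symm.toLinearMap

/-- The partial trace over the second factor: the linear map with `A ⊗ B ↦ tr(B) • A`. -/
def partialTrace (K E : FdHilb) : Op (K ⊗ʰ E) →ₗ[ℂ] Op K :=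
  (TensorProduct.rid ℂ (Op K)).toLinearMap ∘ₗ
    LinearMap.lTensor (Op K) (LinearMap.trace ℂ E) ∘ₗ (opEquiv K E).symm.toLinearMap

/-- A completely positive map, in the form given by the CPM construction: a doubled map
followed by the discarding of an auxiliary system `E`. -/
def IsCP (Φ : Op H →ₗ[ℂ] Op K) : Prop :=
  ∃ (E : FdHilb) (f : H →ₗ[ℂ] K ⊗ʰ E), Φ = partialTrace K E ∘ₗ doubled f

/-! ### Classical structures and maps of density hypercubes -/

/-- A classical structure on `G`: a special commutative †-Frobenius algebra in finite-dimensional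
Hilbert spaces. The unit `ℂ → G` is given by the vector which is the image of `1`; the
comultiplication and the counit are the adjoints of the multiplication and the unit. -/
structure ClassicalStructure (G : FdHilb) where
  mul : G ⊗ʰ G →ₗ[ℂ] G
  unit : G
  mul_assoc : ∀ x y z : G, mul (mul (x ⊗ᵗ y) ⊗ᵗ z) = mul (x ⊗ᵗ mul (y ⊗ᵗ z))
  mul_comm : ∀ x y : G, mul (x ⊗ᵗ y) = mul (y ⊗ᵗ x)
  unit_mul : ∀ x : G, mul (unit ⊗ᵗ x) = x
  special : mul ∘ₗ dag mul = LinearMap.id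
  frobenius : map mul LinearMap.id ∘ₗ assocInv G G G ∘ₗ map LinearMap.id (dag mul) =
    dag mul ∘ₗ mul

namespace ClassicalStructure

/-- The comultiplication. -/
def comul (Z : ClassicalStructure G) : G →ₗ[ℂ] G ⊗ʰ G := dag Z.mul

/-- The counit. -/
def counit (Z : ClassicalStructure G) : G →ₗ[ℂ] ℂ := innerₛₗ ℂ Z.unit

/-- The bridge: the multiplication followed by the counit. -/
def bridge (Z : ClassicalStructure G) : G ⊗ʰ G →ₗ[ℂ] ℂ := Z.counit ∘ₗ Z.mul

end ClassicalStructure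

/-- Two copies of `f : H → G ⊗ K ⊗ E` with the two outputs `G` joined by the bridge of a
classical structure on `G`. -/
def bridged (Z : ClassicalStructure G) (f : H →ₗ[ℂ] G ⊗ʰ (K ⊗ʰ E)) :
    H ⊗ʰ H →ₗ[ℂ] (K ⊗ʰ K) ⊗ʰ (E ⊗ʰ E) :=
  swapMid K E K E ∘ₗ applyFst Z.bridge ((K ⊗ʰ E) ⊗ʰ (K ⊗ʰ E)) ∘ₗ
    swapMid G (K ⊗ʰ E) G (K ⊗ʰ E) ∘ₗ map f f

/-- A map of density hypercubes: two copies of the doubling of `f : H → G ⊗ K ⊗ E`, with the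
two doubled outputs `G` joined by the doubled bridge of a classical structure, and both
doubled outputs `E` discarded. -/
def IsDD (Φ : Op (H ⊗ʰ H) →ₗ[ℂ] Op (K ⊗ʰ K)) : Prop :=
  ∃ (G E : FdHilb) (Z : ClassicalStructure G) (f : H →ₗ[ℂ] G ⊗ʰ (K ⊗ʰ E)),
    Φ = partialTrace (K ⊗ʰ K) (E ⊗ʰ E) ∘ₗ doubled (bridged Z f)

/-! ### Helper facts: operators -/

@[simp]
theorem doubled_apply (f : H →ₗ[ℂ] K) (ρ : Op H) : doubled f ρ = f ∘ₗ ρ ∘ₗ dag f := rfl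

theorem doubled_comp (g : K →ₗ[ℂ] L) (f : H →ₗ[ℂ] K) :
    doubled (g ∘ₗ f) = doubled g ∘ₗ doubled f := by
  ext1 ρ
  simp [dag_comp, LinearMap.comp_assoc]

@[simp]
theorem doubled_id : doubled (LinearMap.id : H →ₗ[ℂ] H) = LinearMap.id := by
  ext1 ρ
  simp

theorem doubled_smul (c : ℂ) (f : H →ₗ[ℂ] K) : doubled (c • f) = (c * star c) • doubled f := by
  ext1 ρ
  simp [LinearMap.comp_smul, LinearMap.smul_comp, smul_smul, mul_comm]

theorem opEquiv_tmul (A : Op H) (B : Op K) : opEquiv H K (A ⊗ₜ B) = map A B :=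
  (homTensorHomEquiv_apply (R := ℂ) (A ⊗ₜ[ℂ] B)).trans rfl

theorem opEquiv_symm_map (A : Op H) (B : Op K) : (opEquiv H K).symm (map A B) = A ⊗ₜ B := by
  rw [LinearEquiv.symm_apply_eq, opEquiv_tmul]

theorem op_ext {Φ Ψ : Op (H ⊗ʰ K) →ₗ[ℂ] M}
    (h : ∀ (A : Op H) (B : Op K), Φ (map A B) = Ψ (map A B)) : Φ = Ψ := by
  have : Φ ∘ₗ (opEquiv H K).toLinearMap = Ψ ∘ₗ (opEquiv H K).toLinearMap :=
    TensorProduct.ext' fun A B => by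
      simp only [LinearMap.comp_apply, LinearEquiv.coe_coe, opEquiv_tmul]
      exact h A B
  ext1 X
  have h2 := LinearMap.congr_fun this ((opEquiv H K).symm X)
  simp only [LinearMap.comp_apply, LinearEquiv.coe_coe, LinearEquiv.apply_symm_apply] at h2
  exact h2

/-- `map` as a bilinear map on operators. -/
def mapₗ (H K : FdHilb) : Op H →ₗ[ℂ] Op K →ₗ[ℂ] Op (H ⊗ʰ K) :=
  (TensorProduct.mk ℂ (Op H) (Op K)).compr₂ (opEquiv H K).toLinearMap

theorem mapₗ_apply (A : Op H) (B : Op K) : mapₗ H K A B = map A B := opEquiv_tmul A B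

theorem op_ext_l {Φ Ψ : Op ((G ⊗ʰ H) ⊗ʰ K) →ₗ[ℂ] M}
    (h : ∀ (A : Op G) (B : Op H) (C : Op K), Φ (map (map A B) C) = Ψ (map (map A B) C)) :
    Φ = Ψ := by
  refine op_ext fun X C => ?_
  have : Φ ∘ₗ (mapₗ _ _).flip C = Ψ ∘ₗ (mapₗ _ _).flip C := op_ext fun A B => by
    simpa [mapₗ_apply] using h A B C
  simpa [mapₗ_apply] using LinearMap.congr_fun this X

@[simp]
theorem opTensor_map (Φ : Op H →ₗ[ℂ] Op K) (Ψ : Op H' →ₗ[ℂ] Op K') (A : Op H) (B : Op H') :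
    opTensor Φ Ψ (map A B) = map (Φ A) (Ψ B) := by
  simp [opTensor, opEquiv_symm_map, opEquiv_tmul]

theorem opTensor_comp (Φ : Op H →ₗ[ℂ] Op K) (Ψ : Op H' →ₗ[ℂ] Op K')
    (Φ' : Op K →ₗ[ℂ] Op L) (Ψ' : Op K' →ₗ[ℂ] Op L') :
    opTensor (Φ' ∘ₗ Φ) (Ψ' ∘ₗ Ψ) = opTensor Φ' Ψ' ∘ₗ opTensor Φ Ψ :=
  op_ext fun A B => by simp

theorem opTensor_sum {ι κ : Type} [Fintype ι] [Fintype κ] (Φ : ι → Op H →ₗ[ℂ] Op K)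
    (Ψ : κ → Op H' →ₗ[ℂ] Op K') :
    opTensor (∑ i, Φ i) (∑ j, Ψ j) = ∑ p : ι × κ, opTensor (Φ p.1) (Ψ p.2) := by
  refine op_ext fun A B => ?_
  rw [opTensor_map, ← mapₗ_apply]
  simp only [LinearMap.sum_apply, map_sum, Fintype.sum_prod_type, opTensor_map, mapₗ_apply]
  rw [Finset.sum_comm]

@[simp]
theorem partialTrace_map (A : Op K) (B : Op E) :
    partialTrace K E (map A B) = LinearMap.trace ℂ E B • A := by
  simp [partialTrace, opEquiv_symm_map]

theorem doubled_map (f : H →ₗ[ℂ] K) (g : H' →ₗ[ℂ] K') :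
    doubled (map f g) = opTensor (doubled f) (doubled g) := by
  refine op_ext fun A B => ?_
  rw [opTensor_map, doubled_apply, doubled_apply, doubled_apply, dag_map, map_comp, map_comp]

/-! ### Helper facts: Kraus forms -/

/-- Contraction of the second tensor factor with a fixed vector. -/
def slice (K : FdHilb) (e : E) : K ⊗ʰ E →ₗ[ℂ] K :=
  (TensorProduct.rid ℂ K).toLinearMap ∘ₗ LinearMap.lTensor K (innerₛₗ ℂ e)

@[simp]
theorem slice_tm (e : E) (k : K) (x : E) : slice K e (tm _ _ k x) = inner ℂ e x • k := rfl

@[simp]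
theorem dag_slice (e : E) (k : K) : dag (slice K e) k = tm _ _ k e := by
  refine vec_ext (hext fun a' b' => ?_)
  simp [dag_inner_left, mul_comm]

theorem partialTrace_eq {ι : Type} [Fintype ι] (b : OrthonormalBasis ι ℂ E) :
    partialTrace K E = ∑ i, doubled (slice K (b i)) := by
  refine op_ext fun A B => ?_
  ext1 k
  simp [LinearMap.sum_apply, LinearMap.trace_eq_sum_inner B b, Finset.sum_smul]

/-- The space `ℂ^ι`. -/
abbrev pow (ι : Type) [Fintype ι] : FdHilb := FdHilb.of (EuclideanSpace ℂ ι)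

/-- The standard orthonormal basis of `ℂ^ι`. -/
def stdB (ι : Type) [Fintype ι] [DecidableEq ι] : OrthonormalBasis ι ℂ (pow ι) :=
  EuclideanSpace.basisFun ι ℂ

/-- The product of orthonormal bases. -/
def prodB {ι κ : Type} [Fintype ι] [Fintype κ] (b : OrthonormalBasis ι ℂ H)
    (c : OrthonormalBasis κ ℂ K) : OrthonormalBasis (ι × κ) ℂ (H ⊗ʰ K) := b.tensorProduct c

theorem prodB_apply {ι κ : Type} [Fintype ι] [Fintype κ] (b : OrthonormalBasis ι ℂ H)
    (c : OrthonormalBasis κ ℂ K) (p : ι × κ) : prodB b c p = tm _ _ (b p.1) (c p.2) :=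
  OrthonormalBasis.tensorProduct_apply' b c p

theorem onb_ext {ι : Type} [Fintype ι] (b : OrthonormalBasis ι ℂ H) {f g : H →ₗ[ℂ] M}
    (h : ∀ i, f (b i) = g (b i)) : f = g := b.toBasis.ext fun i => by simpa using h i

theorem slice_tm_flip {ι : Type} [Fintype ι] [DecidableEq ι] (b : OrthonormalBasis ι ℂ E)
    (i j : ι) : slice K (b i) ∘ₗ (tm K E).flip (b j) = if i = j then LinearMap.id else 0 := by
  ext1 x
  by_cases hij : i = j <;> simp [b.inner_eq_ite, hij]

theorem isCP_iff (Φ : Op H →ₗ[ℂ] Op K) :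
    IsCP Φ ↔ ∃ (ι : Type) (_ : Fintype ι) (k : ι → H →ₗ[ℂ] K), Φ = ∑ i, doubled (k i) := by
  constructor
  · rintro ⟨E, f, rfl⟩
    refine ⟨_, inferInstance, fun i => slice K (stdOrthonormalBasis ℂ E i) ∘ₗ f, ?_⟩
    rw [partialTrace_eq (stdOrthonormalBasis ℂ E)]
    simp only [doubled_comp]
    ext1 ρ
    simp [LinearMap.sum_apply]
  · rintro ⟨ι, _, k, rfl⟩
    classical
    refine ⟨pow ι, ∑ i, (tm K (pow ι)).flip (stdB ι i) ∘ₗ k i, ?_⟩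
    rw [partialTrace_eq (stdB ι)]
    have h : ∀ j, slice K (stdB ι j) ∘ₗ (∑ i, (tm K (pow ι)).flip (stdB ι i) ∘ₗ k i) = k j := by
      intro j
      ext1 x
      have h1 := fun i => LinearMap.congr_fun (slice_tm_flip (K := K) (stdB ι) j i) (k i x)
      simp only [LinearMap.comp_apply, LinearMap.sum_apply, map_sum] at h1 ⊢
      simp only [h1]
      rw [Finset.sum_eq_single j (fun i _ hi => by simp [Ne.symm hi]) (by simp)]
      simp
    ext1 ρ
    rw [LinearMap.comp_apply, LinearMap.sum_apply, LinearMap.sum_apply]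
    refine Finset.sum_congr rfl fun j _ => ?_
    rw [← LinearMap.comp_apply, ← doubled_comp, h]

/-- Joining the outputs `G` of two maps by a bridge. -/
def contract (Z : ClassicalStructure G) (a b : H →ₗ[ℂ] G ⊗ʰ K) : H ⊗ʰ H →ₗ[ℂ] K ⊗ʰ K :=
  applyFst Z.bridge (K ⊗ʰ K) ∘ₗ swapMid G K G K ∘ₗ map a b

theorem slice_bridged (Z : ClassicalStructure G) (f : H →ₗ[ℂ] G ⊗ʰ (K ⊗ʰ E)) (e e' : E) :
    slice (K ⊗ʰ K) (tm _ _ e e') ∘ₗ bridged Z f =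
      contract Z (map LinearMap.id (slice K e) ∘ₗ f) (map LinearMap.id (slice K e') ∘ₗ f) := by
  have key : slice (K ⊗ʰ K) (tm _ _ e e') ∘ₗ
      swapMid K E K E ∘ₗ applyFst Z.bridge ((K ⊗ʰ E) ⊗ʰ (K ⊗ʰ E)) ∘ₗ
        swapMid G (K ⊗ʰ E) G (K ⊗ʰ E) =
      applyFst Z.bridge (K ⊗ʰ K) ∘ₗ swapMid G K G K ∘ₗ
      map (map LinearMap.id (slice K e)) (map LinearMap.id (slice K e')) := by
    refine hext6 fun g k x g' k' x' => ?_
    simp [smul_smul, mul_comm]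
  unfold bridged contract
  rw [map_comp]
  simp only [← LinearMap.comp_assoc] at key ⊢
  rw [key]

theorem isDD_iff (Φ : Op (H ⊗ʰ H) →ₗ[ℂ] Op (K ⊗ʰ K)) :
    IsDD Φ ↔ ∃ (ι : Type) (_ : Fintype ι) (G : FdHilb) (Z : ClassicalStructure G)
      (k : ι → H →ₗ[ℂ] G ⊗ʰ K), Φ = ∑ p : ι × ι, doubled (contract Z (k p.1) (k p.2)) := by
  constructor
  · rintro ⟨G, E, Z, f, rfl⟩
    let b := stdOrthonormalBasis ℂ E
    refine ⟨_, inferInstance, G, Z, fun i => map LinearMap.id (slice K (b i)) ∘ₗ f, ?_⟩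
    rw [partialTrace_eq (prodB b b)]
    ext1 ρ
    rw [LinearMap.comp_apply, LinearMap.sum_apply, LinearMap.sum_apply]
    refine Finset.sum_congr rfl fun p _ => ?_
    rw [← LinearMap.comp_apply, ← doubled_comp, prodB_apply, slice_bridged]
  · rintro ⟨ι, _, G, Z, k, rfl⟩
    classical
    refine ⟨G, pow ι, Z, ∑ i, map LinearMap.id ((tm K (pow ι)).flip (stdB ι i)) ∘ₗ k i, ?_⟩
    rw [partialTrace_eq (prodB (stdB ι) (stdB ι))]
    have h : ∀ j, map LinearMap.id (slice K (stdB ι j)) ∘ₗ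
        (∑ i, map LinearMap.id ((tm K (pow ι)).flip (stdB ι i)) ∘ₗ k i) = k j := by
      intro j
      have h1 : ∀ i, (map LinearMap.id (slice K (stdB ι j)) : G ⊗ʰ (K ⊗ʰ pow ι) →ₗ[ℂ] G ⊗ʰ K) ∘ₗ
          map LinearMap.id ((tm K (pow ι)).flip (stdB ι i)) =
          if j = i then LinearMap.id else 0 := by
        intro i
        rw [← map_comp, slice_tm_flip]
        split_ifs
        · exact map_id
        · exact hext fun x y => by simp
      ext1 x
      have h2 := fun i => LinearMap.congr_fun (h1 i) (k i x)
      simp only [LinearMap.comp_apply, LinearMap.sum_apply, map_sum] at h2 ⊢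
      simp only [h2]
      rw [Finset.sum_eq_single j (fun i _ hi => by simp [Ne.symm hi]) (by simp)]
      simp
    ext1 ρ
    rw [LinearMap.comp_apply, LinearMap.sum_apply, LinearMap.sum_apply]
    refine Finset.sum_congr rfl fun p _ => ?_
    rw [← LinearMap.comp_apply, ← doubled_comp, prodB_apply, slice_bridged, h, h]

theorem IsDD.isCP {Φ : Op (H ⊗ʰ H) →ₗ[ℂ] Op (K ⊗ʰ K)} (h : IsDD Φ) : IsCP Φ := by
  obtain ⟨G, E, Z, f, rfl⟩ := h
  exact ⟨E ⊗ʰ E, bridged Z f, rfl⟩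

/-! ### Helper facts: constructions of classical structures -/

namespace ClassicalStructure

theorem counit_comul (Z : ClassicalStructure G) :
    applyFst Z.counit G ∘ₗ Z.comul = LinearMap.id := by
  ext1 x
  refine ext_inner_left ℂ fun y => ?_
  rw [LinearMap.comp_apply, ← dag_inner_left, counit, dag_applyFst, comul, dag_inner_right,
    Z.unit_mul, LinearMap.id_apply]

theorem comul_mul (Z : ClassicalStructure G) (x y : G) :
    Z.comul (Z.mul (x ⊗ᵗ y)) = map (Z.mul ∘ₗ tm G G x) LinearMap.id (Z.comul y) := by
  have h := LinearMap.congr_fun Z.frobenius (x ⊗ᵗ y)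
  have h2 : map Z.mul LinearMap.id ∘ₗ assocInv G G G ∘ₗ tm G (G ⊗ʰ G) x =
      map (Z.mul ∘ₗ tm G G x) LinearMap.id := hext fun a b => by simp
  rw [comul, ← h2]
  simpa using h.symm

/-- The bridge joining two comultiplications is the multiplication followed by the
comultiplication. -/
theorem contract_comul (Z : ClassicalStructure G) :
    contract Z Z.comul Z.comul = Z.comul ∘ₗ Z.mul := by
  have h1 : ∀ x, applyFst Z.bridge (G ⊗ʰ G) ∘ₗ swapMid G G G G ∘ₗ tm _ _ (Z.comul x) =
      map (Z.mul ∘ₗ tm G G x) LinearMap.id := by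
    intro x
    refine hext fun y1 y2 => ?_
    have h2 : applyFst Z.bridge (G ⊗ʰ G) ∘ₗ swapMid G G G G ∘ₗ (tm _ _).flip (y1 ⊗ᵗ y2) =
        (tm G G).flip y2 ∘ₗ applyFst Z.counit G ∘ₗ map (Z.mul ∘ₗ tm G G y1) LinearMap.id :=
      hext fun x1 x2 => by simp [bridge, Z.mul_comm x1 y1]
    have h3 := LinearMap.congr_fun h2 (Z.comul x)
    have h4 := LinearMap.congr_fun Z.counit_comul (Z.mul (y1 ⊗ᵗ x))
    rw [LinearMap.comp_apply, comul_mul] at h4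
    simp only [LinearMap.comp_apply, LinearMap.flip_apply] at h3 ⊢
    rw [h3, h4]
    simp [Z.mul_comm x y1]
  refine hext fun x y => ?_
  rw [LinearMap.comp_apply, comul_mul, ← h1]
  rfl

theorem dag_tensor_mul (Z : ClassicalStructure G) (W : ClassicalStructure G') :
    dag (map Z.mul W.mul ∘ₗ swapMid G G' G G') =
      swapMid G G G' G' ∘ₗ map Z.comul W.comul := by
  rw [dag_comp, dag_map, dag_swapMid, comul, comul]

/-- The tensor product of classical structures. -/
def tensor (Z : ClassicalStructure G) (W : ClassicalStructure G') :
    ClassicalStructure (G ⊗ʰ G') where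
  mul := map Z.mul W.mul ∘ₗ swapMid G G' G G'
  unit := Z.unit ⊗ᵗ W.unit
  mul_assoc := by
    intro x y z
    have : (map Z.mul W.mul ∘ₗ swapMid G G' G G') ∘ₗ
        map (map Z.mul W.mul ∘ₗ swapMid G G' G G') LinearMap.id =
        (map Z.mul W.mul ∘ₗ swapMid G G' G G') ∘ₗ
        map LinearMap.id (map Z.mul W.mul ∘ₗ swapMid G G' G G') ∘ₗ assoc _ _ _ := by
      refine hext fun t z => ?_
      have : ((map Z.mul W.mul ∘ₗ swapMid G G' G G') ∘ₗ
          map (map Z.mul W.mul ∘ₗ swapMid G G' G G') LinearMap.id) ∘ₗ (tm _ _).flip z =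
          ((map Z.mul W.mul ∘ₗ swapMid G G' G G') ∘ₗ
          map LinearMap.id (map Z.mul W.mul ∘ₗ swapMid G G' G G') ∘ₗ assoc _ _ _) ∘ₗ
            (tm _ _).flip z := by
        refine hext4 fun a a' b b' => ?_
        have : ((map Z.mul W.mul ∘ₗ swapMid G G' G G') ∘ₗ
            map (map Z.mul W.mul ∘ₗ swapMid G G' G G') LinearMap.id) ∘ₗ
              tm _ _ ((a ⊗ᵗ a') ⊗ᵗ (b ⊗ᵗ b')) =
            ((map Z.mul W.mul ∘ₗ swapMid G G' G G') ∘ₗ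
            map LinearMap.id (map Z.mul W.mul ∘ₗ swapMid G G' G G') ∘ₗ assoc _ _ _) ∘ₗ
              tm _ _ ((a ⊗ᵗ a') ⊗ᵗ (b ⊗ᵗ b')) :=
          hext fun c c' => by simp [Z.mul_assoc, W.mul_assoc]
        exact LinearMap.congr_fun this z
      exact LinearMap.congr_fun this t
    exact LinearMap.congr_fun this ((x ⊗ᵗ y) ⊗ᵗ z)
  mul_comm := by
    intro x y
    have : tm _ _ ∘ₗ LinearMap.id = (tm (G ⊗ʰ G') (G ⊗ʰ G')) := rfl
    have h : (tm (G ⊗ʰ G') (G ⊗ʰ G')).compr₂ (map Z.mul W.mul ∘ₗ swapMid G G' G G') =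
        (tm (G ⊗ʰ G') (G ⊗ʰ G')).flip.compr₂ (map Z.mul W.mul ∘ₗ swapMid G G' G G') := by
      refine hext fun a a' => hext fun b b' => ?_
      simp [Z.mul_comm a b, W.mul_comm a' b']
    exact LinearMap.congr_fun (LinearMap.congr_fun h x) y
  unit_mul := by
    intro x
    have : (map Z.mul W.mul ∘ₗ swapMid G G' G G') ∘ₗ tm _ _ (Z.unit ⊗ᵗ W.unit) =
        LinearMap.id := hext fun a a' => by simp [Z.unit_mul, W.unit_mul]
    exact LinearMap.congr_fun this x
  special := by
    rw [dag_tensor_mul, LinearMap.comp_assoc, ← LinearMap.comp_assoc (map Z.comul W.comul),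
      swapMid_swapMid, LinearMap.id_comp, ← map_comp, comul, comul, Z.special, W.special, map_id]
  frobenius := by
    rw [dag_tensor_mul]
    refine hext4 fun x x' y y' => ?_
    have h : map (map Z.mul W.mul ∘ₗ swapMid G G' G G') LinearMap.id ∘ₗ
        assocInv (G ⊗ʰ G') (G ⊗ʰ G') (G ⊗ʰ G') ∘ₗ tm _ _ (x ⊗ᵗ x') ∘ₗ swapMid G G G' G' =
        swapMid G G G' G' ∘ₗ map (map (Z.mul ∘ₗ tm G G x) LinearMap.id)
          (map (W.mul ∘ₗ tm G' G' x') LinearMap.id) :=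
      hext4 fun a b a' b' => by simp
    have h1 := LinearMap.congr_fun h (Z.comul y ⊗ᵗ W.comul y')
    simp only [LinearMap.comp_apply, map_tm, ← comul_mul] at h1
    simpa using h1

/-- The classical structure copying the vectors of an orthonormal basis. -/
def ofBasis {ι : Type} [Fintype ι] [DecidableEq ι] (b : OrthonormalBasis ι ℂ G) :
    ClassicalStructure G :=
  let m : G ⊗ʰ G →ₗ[ℂ] G := ∑ i, (innerₛₗ ℂ (b i ⊗ᵗ b i)).smulRight (b i)
  have hm : ∀ i j, m (b i ⊗ᵗ b j) = if i = j then b i else 0 := by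
    intro i j
    simp only [m, LinearMap.sum_apply, LinearMap.smulRight_apply, innerₛₗ_apply_apply,
      inner_tm, b.inner_eq_ite]
    by_cases h : i = j
    · subst h; simp
    · rw [if_neg h]
      refine Finset.sum_eq_zero fun k _ => ?_
      by_cases h1 : k = i
      · subst h1; simp [h]
      · simp [h1]
  have hm' : ∀ i, dag m (b i) = b i ⊗ᵗ b i := by
    intro i
    refine ext_inner_right ℂ fun v => ?_
    rw [dag_inner_left]
    simp [m, LinearMap.sum_apply, b.inner_eq_ite]
  have ext2 : ∀ {M : Type} [AddCommMonoid M] [Module ℂ M] (f g : G ⊗ʰ G →ₗ[ℂ] M),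
      (∀ i j, f (b i ⊗ᵗ b j) = g (b i ⊗ᵗ b j)) → f = g := fun f g h =>
    onb_ext (prodB b b) fun i => by simpa [prodB_apply] using h i.1 i.2
  { mul := m
    unit := ∑ i, b i
    mul_assoc := by
      intro x y z
      have : m ∘ₗ map m LinearMap.id = m ∘ₗ map LinearMap.id m ∘ₗ assoc G G G := by
        refine onb_ext (prodB (prodB b b) b) fun i => ?_
        obtain ⟨⟨i, j⟩, k⟩ := i
        by_cases h1 : i = j <;> by_cases h2 : j = k
        · subst h1; subst h2; simp [prodB_apply, hm]
        · subst h1; simp [prodB_apply, hm, h2]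
        · subst h2; simp [prodB_apply, hm, h1]
        · simp [prodB_apply, hm, h1, h2]
      exact LinearMap.congr_fun this ((x ⊗ᵗ y) ⊗ᵗ z)
    mul_comm := by
      intro x y
      have h : (tm G G).compr₂ m = (tm G G).flip.compr₂ m := by
        refine onb_ext b fun i => onb_ext b fun j => ?_
        by_cases h : i = j
        · subst h; simp
        · simp [hm, h, Ne.symm h]
      exact LinearMap.congr_fun (LinearMap.congr_fun h x) y
    unit_mul := by
      intro x
      have h : m ∘ₗ tm G G (∑ i, b i) = LinearMap.id := by
        refine onb_ext b fun j => ?_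
        simp [hm]
      exact LinearMap.congr_fun h x
    special := by
      refine onb_ext b fun i => ?_
      simp [hm', hm]
    frobenius := by
      refine ext2 _ _ fun i j => ?_
      by_cases h : i = j
      · subst h; simp [hm', hm]
      · simp [hm', hm, h] }

theorem ofBasis_mul {ι : Type} [Fintype ι] [DecidableEq ι] (b : OrthonormalBasis ι ℂ G)
    (i j : ι) : (ofBasis b).mul (b i ⊗ᵗ b j) = if i = j then b i else 0 := by
  change (∑ i, (innerₛₗ ℂ (b i ⊗ᵗ b i)).smulRight (b i)) (b i ⊗ᵗ b j) = _
  simp only [LinearMap.sum_apply, LinearMap.smulRight_apply, innerₛₗ_apply_apply,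
    inner_tm, b.inner_eq_ite]
  by_cases h : i = j
  · subst h; simp
  · rw [if_neg h]
    refine Finset.sum_eq_zero fun k _ => ?_
    by_cases h1 : k = i
    · subst h1; simp [h]
    · simp [h1]

theorem ofBasis_bridge {ι : Type} [Fintype ι] [DecidableEq ι] (b : OrthonormalBasis ι ℂ G)
    (i j : ι) : (ofBasis b).bridge (b i ⊗ᵗ b j) = if i = j then 1 else 0 := by
  have hc : (ofBasis b).counit (b i) = 1 := by
    change inner ℂ (∑ i, b i) (b i) = 1
    simp [b.inner_eq_ite]
  rw [bridge, LinearMap.comp_apply, ofBasis_mul]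
  split_ifs with h
  · exact hc
  · simp

/-- The classical structure on the one-dimensional space given by multiplication. -/
def trivial : ClassicalStructure FdHilb.unit where
  mul := lid FdHilb.unit
  unit := one
  mul_assoc := fun x y z => scal_inj (by simp [mul_left_comm])
  mul_comm := fun x y => scal_inj (by simp [_root_.mul_comm])
  unit_mul := fun x => scal_inj (by simp)
  special := by
    refine LinearMap.ext fun x => ?_
    simp [dag_lid_apply]
  frobenius := by
    refine hext fun x y => ?_
    simp [dag_lid_apply]

@[simp]
theorem trivial_bridge (x y : FdHilb.unit) : trivial.bridge (x ⊗ᵗ y) = scal x * scal y := by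
  simp [bridge, counit, trivial]

end ClassicalStructure

theorem doubled_zero : doubled (0 : H →ₗ[ℂ] K) = 0 := by
  ext1 ρ
  simp

/-! ### Helper facts: closure properties of completely positive maps -/

theorem isCP_doubled (f : H →ₗ[ℂ] K) : IsCP (doubled f) :=
  (isCP_iff _).mpr ⟨Unit, inferInstance, fun _ => f, by simp⟩

theorem isCP_zero : IsCP (0 : Op H →ₗ[ℂ] Op K) :=
  (isCP_iff _).mpr ⟨Empty, inferInstance, Empty.elim, by simp⟩

theorem IsCP.add {Φ Ψ : Op H →ₗ[ℂ] Op K} (h : IsCP Φ) (h' : IsCP Ψ) : IsCP (Φ + Ψ) := by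
  obtain ⟨ι, _, k, rfl⟩ := (isCP_iff _).mp h
  obtain ⟨κ, _, l, rfl⟩ := (isCP_iff _).mp h'
  exact (isCP_iff _).mpr ⟨ι ⊕ κ, inferInstance, Sum.elim k l, by simp⟩

theorem coe_mul_star (c : ℝ≥0) (a : ℝ) (h : a * a = c) : ((a : ℂ) * star (a : ℂ)) = (c : ℝ) := by
  rw [← h]; simp

theorem nnreal_smul (c : ℝ≥0) (Φ : Op H →ₗ[ℂ] Op K) : c • Φ = ((c : ℝ) : ℂ) • Φ := by
  ext ρ x
  simp [NNReal.smul_def]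

theorem IsCP.smul (c : ℝ≥0) {Φ : Op H →ₗ[ℂ] Op K} (h : IsCP Φ) : IsCP (c • Φ) := by
  obtain ⟨ι, _, k, rfl⟩ := (isCP_iff _).mp h
  refine (isCP_iff _).mpr ⟨ι, inferInstance, fun i => ((Real.sqrt c : ℝ) : ℂ) • k i, ?_⟩
  simp only [doubled_smul, coe_mul_star c _ (Real.mul_self_sqrt c.2), nnreal_smul,
    Finset.smul_sum]

theorem sum_comp_sum {ι κ : Type} [Fintype ι] [Fintype κ] (Ψ : κ → Op K →ₗ[ℂ] Op L)
    (Φ : ι → Op H →ₗ[ℂ] Op K) : (∑ j, Ψ j) ∘ₗ (∑ i, Φ i) = ∑ p : κ × ι, Ψ p.1 ∘ₗ Φ p.2 := by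
  ext1 ρ
  simp only [LinearMap.comp_apply, LinearMap.sum_apply, map_sum, Fintype.sum_prod_type]
  rw [Finset.sum_comm]

theorem IsCP.comp {Φ : Op H →ₗ[ℂ] Op K} {Ψ : Op K →ₗ[ℂ] Op L} (h' : IsCP Ψ) (h : IsCP Φ) :
    IsCP (Ψ ∘ₗ Φ) := by
  obtain ⟨ι, _, k, rfl⟩ := (isCP_iff _).mp h
  obtain ⟨κ, _, l, rfl⟩ := (isCP_iff _).mp h'
  refine (isCP_iff _).mpr ⟨κ × ι, inferInstance, fun p => l p.1 ∘ₗ k p.2, ?_⟩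
  simp only [doubled_comp, sum_comp_sum]

theorem IsCP.opTensor {Φ : Op H →ₗ[ℂ] Op K} {Ψ : Op H' →ₗ[ℂ] Op K'} (h : IsCP Φ) (h' : IsCP Ψ) :
    IsCP (opTensor Φ Ψ) := by
  obtain ⟨ι, _, k, rfl⟩ := (isCP_iff _).mp h
  obtain ⟨κ, _, l, rfl⟩ := (isCP_iff _).mp h'
  refine (isCP_iff _).mpr ⟨ι × κ, inferInstance, fun p => map (k p.1) (l p.2), ?_⟩
  simp only [doubled_map, opTensor_sum]

/-! ### Helper facts: closure properties of maps of density hypercubes -/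

/-- A map `H → K` with a trivial output `ℂ` added. -/
def withUnit (f : H →ₗ[ℂ] K) : H →ₗ[ℂ] FdHilb.unit ⊗ʰ K := tm _ _ one ∘ₗ f

theorem contract_withUnit (f g : H →ₗ[ℂ] K) :
    contract ClassicalStructure.trivial (withUnit f) (withUnit g) = map f g :=
  hext fun x y => by simp [contract, withUnit]

theorem isDD_sum {ι : Type} [Fintype ι] (k : ι → H →ₗ[ℂ] K) :
    IsDD (∑ p : ι × ι, doubled (map (k p.1) (k p.2))) :=
  (isDD_iff _).mpr ⟨ι, inferInstance, FdHilb.unit, ClassicalStructure.trivial,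
    fun i => withUnit (k i), by simp only [contract_withUnit]⟩

theorem isDD_doubled (f : H →ₗ[ℂ] K) : IsDD (doubled (map f f)) := by
  simpa using isDD_sum (fun _ : Unit => f)

theorem isDD_zero : IsDD (0 : Op (H ⊗ʰ H) →ₗ[ℂ] Op (K ⊗ʰ K)) := by
  simpa using isDD_sum (fun e : Empty => (e.elim : H →ₗ[ℂ] K))

theorem contract_smul (Z : ClassicalStructure G) (c d : ℂ) (f g : H →ₗ[ℂ] G ⊗ʰ K) :
    contract Z (c • f) (d • g) = (c * d) • contract Z f g :=
  hext fun x y => by simp [contract, smul_smul, mul_comm]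

theorem IsDD.smul (c : ℝ≥0) {Φ : Op (H ⊗ʰ H) →ₗ[ℂ] Op (K ⊗ʰ K)} (h : IsDD Φ) :
    IsDD (c • Φ) := by
  obtain ⟨ι, _, G, Z, k, rfl⟩ := (isDD_iff _).mp h
  let s : ℝ := Real.sqrt (Real.sqrt c)
  have hs : s * s = Real.sqrt c := Real.mul_self_sqrt (Real.sqrt_nonneg _)
  have hs' : (s * s) * (s * s) = c := by
    rw [hs]
    exact Real.mul_self_sqrt c.2
  refine (isDD_iff _).mpr ⟨ι, inferInstance, G, Z, fun i => (s : ℂ) • k i, ?_⟩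
  simp only [contract_smul, ← Complex.ofReal_mul, doubled_smul, coe_mul_star c _ hs',
    nnreal_smul, Finset.smul_sum]

theorem contract_comp (Z : ClassicalStructure G) (Z' : ClassicalStructure G')
    (a b : H →ₗ[ℂ] G ⊗ʰ K) (a' b' : K →ₗ[ℂ] G' ⊗ʰ L) :
    contract (Z.tensor Z') (assocInv G G' L ∘ₗ map LinearMap.id a' ∘ₗ a)
      (assocInv G G' L ∘ₗ map LinearMap.id b' ∘ₗ b) = contract Z' a' b' ∘ₗ contract Z a b := by
  have key : applyFst (Z.tensor Z').bridge (L ⊗ʰ L) ∘ₗ swapMid (G ⊗ʰ G') L (G ⊗ʰ G') L ∘ₗ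
      map (assocInv G G' L) (assocInv G G' L) =
      applyFst Z'.bridge (L ⊗ʰ L) ∘ₗ swapMid G' L G' L ∘ₗ
        applyFst Z.bridge ((G' ⊗ʰ L) ⊗ʰ (G' ⊗ʰ L)) ∘ₗ swapMid G (G' ⊗ʰ L) G (G' ⊗ʰ L) := by
    refine hext6 fun g g' l h h' l' => ?_
    simp [ClassicalStructure.bridge, ClassicalStructure.tensor, ClassicalStructure.counit,
      smul_smul]
  have key2 : applyFst Z.bridge ((G' ⊗ʰ L) ⊗ʰ (G' ⊗ʰ L)) ∘ₗ swapMid G (G' ⊗ʰ L) G (G' ⊗ʰ L) ∘ₗ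
      map (map LinearMap.id a') (map LinearMap.id b') =
      map a' b' ∘ₗ applyFst Z.bridge (K ⊗ʰ K) ∘ₗ swapMid G K G K :=
    hext4 fun g k g' k' => by simp
  unfold contract
  rw [map_comp, map_comp]
  ext1 x
  have h1 := LinearMap.congr_fun key (map (map LinearMap.id a') (map LinearMap.id b') (map a b x))
  have h2 := LinearMap.congr_fun key2 (map a b x)
  simp only [LinearMap.comp_apply] at h1 h2 ⊢
  rw [h1, h2]

theorem IsDD.comp {Φ : Op (H ⊗ʰ H) →ₗ[ℂ] Op (K ⊗ʰ K)} {Ψ : Op (K ⊗ʰ K) →ₗ[ℂ] Op (L ⊗ʰ L)}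
    (h' : IsDD Ψ) (h : IsDD Φ) : IsDD (Ψ ∘ₗ Φ) := by
  obtain ⟨ι, _, G, Z, k, rfl⟩ := (isDD_iff _).mp h
  obtain ⟨κ, _, G', Z', l, rfl⟩ := (isDD_iff _).mp h'
  refine (isDD_iff _).mpr ⟨κ × ι, inferInstance, G ⊗ʰ G', Z.tensor Z',
    fun p => assocInv G G' L ∘ₗ map LinearMap.id (l p.1) ∘ₗ k p.2, ?_⟩
  simp only [contract_comp, doubled_comp, sum_comp_sum]
  exact Fintype.sum_equiv (Equiv.prodProdProdComm κ κ ι ι) _ _ fun p => rfl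

/-- The tensor product of maps on pairs of doubled systems, with the systems reordered. -/
def ddTensor (Φ : Op (H ⊗ʰ H) →ₗ[ℂ] Op (K ⊗ʰ K)) (Ψ : Op (H' ⊗ʰ H') →ₗ[ℂ] Op (K' ⊗ʰ K')) :
    Op ((H ⊗ʰ H') ⊗ʰ (H ⊗ʰ H')) →ₗ[ℂ] Op ((K ⊗ʰ K') ⊗ʰ (K ⊗ʰ K')) :=
  doubled (swapMid K K K' K') ∘ₗ opTensor Φ Ψ ∘ₗ doubled (swapMid H H' H H')

theorem contract_tensor (Z : ClassicalStructure G) (Z' : ClassicalStructure G')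
    (a b : H →ₗ[ℂ] G ⊗ʰ K) (a' b' : H' →ₗ[ℂ] G' ⊗ʰ K') :
    contract (Z.tensor Z') (swapMid G K G' K' ∘ₗ map a a') (swapMid G K G' K' ∘ₗ map b b') =
      swapMid K K K' K' ∘ₗ map (contract Z a b) (contract Z' a' b') ∘ₗ swapMid H H' H H' := by
  have key : applyFst (Z.tensor Z').bridge _ ∘ₗ swapMid (G ⊗ʰ G') (K ⊗ʰ K') (G ⊗ʰ G') (K ⊗ʰ K') ∘ₗ
      map (swapMid G K G' K') (swapMid G K G' K') ∘ₗ swapMid (G ⊗ʰ K) (G ⊗ʰ K) (G' ⊗ʰ K') (G' ⊗ʰ K')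
      =
      swapMid K K K' K' ∘ₗ map (applyFst Z.bridge (K ⊗ʰ K) ∘ₗ swapMid G K G K)
        (applyFst Z'.bridge (K' ⊗ʰ K') ∘ₗ swapMid G' K' G' K') := by
    refine hext fun s t => ?_
    have h : ∀ g k h l, (applyFst (Z.tensor Z').bridge _ ∘ₗ
        swapMid (G ⊗ʰ G') (K ⊗ʰ K') (G ⊗ʰ G') (K ⊗ʰ K') ∘ₗ
        map (swapMid G K G' K') (swapMid G K G' K') ∘ₗ
        swapMid (G ⊗ʰ K) (G ⊗ʰ K) (G' ⊗ʰ K') (G' ⊗ʰ K')) ∘ₗ tm _ _ ((g ⊗ᵗ k) ⊗ᵗ (h ⊗ᵗ l)) =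
        (swapMid K K K' K' ∘ₗ map (applyFst Z.bridge (K ⊗ʰ K) ∘ₗ swapMid G K G K)
        (applyFst Z'.bridge (K' ⊗ʰ K') ∘ₗ swapMid G' K' G' K')) ∘ₗ
          tm _ _ ((g ⊗ᵗ k) ⊗ᵗ (h ⊗ᵗ l)) := by
      intro g k h l
      refine hext4 fun g' k' h' l' => ?_
      simp [ClassicalStructure.bridge, ClassicalStructure.tensor, ClassicalStructure.counit,
        smul_smul, mul_comm]
    have h2 : (applyFst (Z.tensor Z').bridge _ ∘ₗ
        swapMid (G ⊗ʰ G') (K ⊗ʰ K') (G ⊗ʰ G') (K ⊗ʰ K') ∘ₗ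
        map (swapMid G K G' K') (swapMid G K G' K') ∘ₗ
        swapMid (G ⊗ʰ K) (G ⊗ʰ K) (G' ⊗ʰ K') (G' ⊗ʰ K')) ∘ₗ (tm _ _).flip t =
        (swapMid K K K' K' ∘ₗ map (applyFst Z.bridge (K ⊗ʰ K) ∘ₗ swapMid G K G K)
        (applyFst Z'.bridge (K' ⊗ʰ K') ∘ₗ swapMid G' K' G' K')) ∘ₗ (tm _ _).flip t :=
      hext4 fun g k h' l => LinearMap.congr_fun (h g k h' l) t
    exact LinearMap.congr_fun h2 s
  refine hext4 fun x x' y y' => ?_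
  have h1 := LinearMap.congr_fun key ((a x ⊗ᵗ b y) ⊗ᵗ (a' x' ⊗ᵗ b' y'))
  simp only [contract, LinearMap.comp_apply, map_tm, swapMid_tm] at h1 ⊢
  exact h1

theorem IsDD.ddTensor {Φ : Op (H ⊗ʰ H) →ₗ[ℂ] Op (K ⊗ʰ K)}
    {Ψ : Op (H' ⊗ʰ H') →ₗ[ℂ] Op (K' ⊗ʰ K')} (h : IsDD Φ) (h' : IsDD Ψ) : IsDD (ddTensor Φ Ψ) := by
  obtain ⟨ι, _, G, Z, k, rfl⟩ := (isDD_iff _).mp h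
  obtain ⟨κ, _, G', Z', l, rfl⟩ := (isDD_iff _).mp h'
  refine (isDD_iff _).mpr ⟨ι × κ, inferInstance, G ⊗ʰ G', Z.tensor Z',
    fun p => swapMid G K G' K' ∘ₗ map (k p.1) (l p.2), ?_⟩
  simp only [contract_tensor, doubled_comp, doubled_map, Hyp.ddTensor, opTensor_sum]
  rw [← Fintype.sum_equiv (Equiv.prodProdProdComm ι ι κ κ) _ _ fun p => rfl]
  ext1 ρ
  simp only [LinearMap.comp_apply, LinearMap.sum_apply, map_sum]
  rfl

/-- A classical structure on a nonzero space has a vector which the bridge pairs to `1` with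
itself. -/
theorem exists_bridge_one (Z : ClassicalStructure G) (h : Z.unit ≠ 0) :
    ∃ v : G, Z.bridge (v ⊗ᵗ v) = 1 := by
  refine ⟨((‖Z.unit‖⁻¹ : ℝ) : ℂ) • Z.unit, ?_⟩
  have h1 : (‖Z.unit‖ : ℂ) ≠ 0 := by simpa using h
  simp [ClassicalStructure.bridge, ClassicalStructure.counit, Z.unit_mul,
    inner_self_eq_norm_sq_to_K]
  field_simp

theorem isDD_of_unit_eq_zero (Z : ClassicalStructure G) (h : Z.unit = 0) {ι : Type} [Fintype ι]
    (k : ι → H →ₗ[ℂ] G ⊗ʰ K) : ∑ p : ι × ι, doubled (contract Z (k p.1) (k p.2)) = 0 := by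
  refine Finset.sum_eq_zero fun p _ => ?_
  have : contract Z (k p.1) (k p.2) = 0 := by
    have h0 : Z.bridge = 0 := by
      ext1 x
      simp [ClassicalStructure.bridge, ClassicalStructure.counit, h]
    have h1 : applyFst Z.bridge (K ⊗ʰ K) = 0 := hext fun x y => by simp [h0]
    rw [contract, h1, LinearMap.zero_comp]
  ext1 ρ
  simp [this]

theorem contract_label (Z : ClassicalStructure G) (Z' : ClassicalStructure G')
    (x y : G) (a b : H →ₗ[ℂ] G' ⊗ʰ K) :
    contract (Z.tensor Z') (assocInv G G' K ∘ₗ tm _ _ x ∘ₗ a) (assocInv G G' K ∘ₗ tm _ _ y ∘ₗ b) =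
      Z.bridge (x ⊗ᵗ y) • contract Z' a b := by
  have key : applyFst (Z.tensor Z').bridge _ ∘ₗ swapMid (G ⊗ʰ G') K (G ⊗ʰ G') K ∘ₗ
      map (assocInv G G' K ∘ₗ tm _ _ x) (assocInv G G' K ∘ₗ tm _ _ y) =
      Z.bridge (x ⊗ᵗ y) • (applyFst Z'.bridge _ ∘ₗ swapMid G' K G' K) := by
    refine hext4 fun g k g' k' => ?_
    simp [ClassicalStructure.bridge, ClassicalStructure.tensor, ClassicalStructure.counit,
      smul_smul]
  refine hext fun u v => ?_
  have h1 := LinearMap.congr_fun key (a u ⊗ᵗ b v)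
  simpa [contract] using h1

theorem contract_padRight (Z : ClassicalStructure G) (Z' : ClassicalStructure G')
    (v : G') (a b : H →ₗ[ℂ] G ⊗ʰ K) :
    contract (Z.tensor Z') (map ((tm G G').flip v) LinearMap.id ∘ₗ a)
      (map ((tm G G').flip v) LinearMap.id ∘ₗ b) = Z'.bridge (v ⊗ᵗ v) • contract Z a b := by
  have key : applyFst (Z.tensor Z').bridge _ ∘ₗ swapMid (G ⊗ʰ G') K (G ⊗ʰ G') K ∘ₗ
      map (map ((tm G G').flip v) LinearMap.id) (map ((tm G G').flip v) LinearMap.id) =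
      Z'.bridge (v ⊗ᵗ v) • (applyFst Z.bridge _ ∘ₗ swapMid G K G K) := by
    refine hext4 fun g k g' k' => ?_
    simp [ClassicalStructure.bridge, ClassicalStructure.tensor, ClassicalStructure.counit,
      smul_smul, mul_comm]
  refine hext fun x y => ?_
  have h1 := LinearMap.congr_fun key (a x ⊗ᵗ b y)
  simpa [contract] using h1

theorem IsDD.add {Φ Ψ : Op (H ⊗ʰ H) →ₗ[ℂ] Op (K ⊗ʰ K)} (h : IsDD Φ) (h' : IsDD Ψ) :
    IsDD (Φ + Ψ) := by
  obtain ⟨ι, _, G, Z, k, rfl⟩ := (isDD_iff _).mp h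
  obtain ⟨κ, _, G', Z', l, rfl⟩ := (isDD_iff _).mp h'
  by_cases hz : Z.unit = 0
  · rw [isDD_of_unit_eq_zero Z hz, zero_add]; exact h'
  by_cases hz' : Z'.unit = 0
  · rw [isDD_of_unit_eq_zero Z' hz', add_zero]; exact h
  obtain ⟨v, hv⟩ := exists_bridge_one Z hz
  obtain ⟨v', hv'⟩ := exists_bridge_one Z' hz'
  let T : ClassicalStructure (pow Bool) := ClassicalStructure.ofBasis (stdB Bool)
  let e : Bool → pow Bool := stdB Bool
  have hT : ∀ i j, T.bridge (e i ⊗ᵗ e j) = if i = j then 1 else 0 :=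
    ClassicalStructure.ofBasis_bridge (stdB Bool)
  let F : ι ⊕ κ → H →ₗ[ℂ] (pow Bool ⊗ʰ (G ⊗ʰ G')) ⊗ʰ K := Sum.elim
    (fun i => assocInv _ _ _ ∘ₗ tm _ _ (e true) ∘ₗ
      map ((tm G G').flip v') LinearMap.id ∘ₗ k i)
    (fun j => assocInv _ _ _ ∘ₗ tm _ _ (e false) ∘ₗ
      assocInv _ _ _ ∘ₗ tm _ _ v ∘ₗ l j)
  refine (isDD_iff _).mpr ⟨ι ⊕ κ, inferInstance, _, T.tensor (Z.tensor Z'), F, ?_⟩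
  have hl : ∀ i j, contract (T.tensor (Z.tensor Z')) (F (Sum.inl i)) (F (Sum.inl j)) =
      contract Z (k i) (k j) := fun i j => by
    refine (contract_label T (Z.tensor Z') (e true) (e true) _ _).trans ?_
    rw [contract_padRight, hT, hv', if_pos rfl, one_smul, one_smul]
  have hr : ∀ i j, contract (T.tensor (Z.tensor Z')) (F (Sum.inr i)) (F (Sum.inr j)) =
      contract Z' (l i) (l j) := fun i j => by
    refine (contract_label T (Z.tensor Z') (e false) (e false) _ _).trans ?_
    rw [contract_label, hT, hv, if_pos rfl, one_smul, one_smul]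
  have hlr : ∀ i j, contract (T.tensor (Z.tensor Z')) (F (Sum.inl i)) (F (Sum.inr j)) = 0 :=
    fun i j => by
      refine (contract_label T (Z.tensor Z') (e true) (e false) _ _).trans ?_
      rw [hT, if_neg (by simp), zero_smul]
  have hrl : ∀ i j, contract (T.tensor (Z.tensor Z')) (F (Sum.inr i)) (F (Sum.inl j)) = 0 :=
    fun i j => by
      refine (contract_label T (Z.tensor Z') (e false) (e true) _ _).trans ?_
      rw [hT, if_neg (by simp), zero_smul]
  simp only [Fintype.sum_prod_type, Fintype.sum_sum_type, hl, hr, hlr, hrl, doubled_zero,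
    Finset.sum_const_zero, add_zero, zero_add]

/-! ### The category of quantum systems and completely positive maps -/

/-- The category of quantum systems and completely positive maps; its objects are the
finite-dimensional Hilbert spaces. -/
structure CPM where
  of ::
  toHilb : FdHilb

namespace CPM

/-- A completely positive map. -/
@[ext]
structure Hom (X Y : CPM) where
  map : Op X.toHilb →ₗ[ℂ] Op Y.toHilb
  isCP : IsCP map

instance : Category CPM where
  Hom := Hom
  id _ := ⟨LinearMap.id, by rw [← doubled_id]; exact isCP_doubled _⟩
  comp f g := ⟨g.map ∘ₗ f.map, g.isCP.comp f.isCP⟩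

variable {X Y W : CPM}

@[ext]
theorem hom_ext {f g : X ⟶ Y} (h : f.map = g.map) : f = g := Hom.ext h

@[simp] theorem id_map : Hom.map (𝟙 X) = LinearMap.id := rfl

@[simp] theorem comp_map (f : X ⟶ Y) (g : Y ⟶ W) : (f ≫ g).map = g.map ∘ₗ f.map := rfl

/-- The doubling of a linear map. -/
def pure (f : H →ₗ[ℂ] K) : CPM.of H ⟶ CPM.of K := ⟨doubled f, isCP_doubled f⟩

@[simp] theorem pure_map (f : H →ₗ[ℂ] K) : (pure f).map = doubled f := rfl

/-- The doubling of an invertible linear map. -/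
@[simps]
def pureIso (f : H →ₗ[ℂ] K) (g : K →ₗ[ℂ] H) (h : g ∘ₗ f = LinearMap.id)
    (h' : f ∘ₗ g = LinearMap.id) : CPM.of H ≅ CPM.of K where
  hom := pure f
  inv := pure g
  hom_inv_id := hom_ext (by simp [← doubled_comp, h])
  inv_hom_id := hom_ext (by simp [← doubled_comp, h'])

/-- The tensor product of completely positive maps. -/
def tensorHom {X X' Y Y' : CPM} (f : X ⟶ Y) (g : X' ⟶ Y') :
    CPM.of (X.toHilb ⊗ʰ X'.toHilb) ⟶ CPM.of (Y.toHilb ⊗ʰ Y'.toHilb) :=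
  ⟨opTensor f.map g.map, f.isCP.opTensor g.isCP⟩

instance : MonoidalCategoryStruct CPM where
  tensorObj X Y := CPM.of (X.toHilb ⊗ʰ Y.toHilb)
  tensorHom f g := tensorHom f g
  whiskerLeft X _ _ f := tensorHom (𝟙 X) f
  whiskerRight f Y := tensorHom f (𝟙 Y)
  tensorUnit := CPM.of FdHilb.unit
  associator X Y Z := pureIso (assoc _ _ _) (assocInv X.toHilb Y.toHilb Z.toHilb)
    (hext_l fun _ _ _ => rfl) (hext_r fun _ _ _ => rfl)
  leftUnitor X := pureIso (lid X.toHilb) (tm _ _ one)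
    (hext fun c x => by rw [LinearMap.comp_apply, lid_tm, eq_scal_smul c]; simp)
    (LinearMap.ext fun x => by simp)
  rightUnitor X := pureIso (rid X.toHilb) ((tm _ _).flip one)
    (hext fun x c => by rw [LinearMap.comp_apply, rid_tm, eq_scal_smul c]; simp)
    (LinearMap.ext fun x => by simp)

@[simp] theorem tensorHom_map {X X' Y Y' : CPM} (f : X ⟶ Y) (g : X' ⟶ Y') :
    (f ⊗ₘ g).map = opTensor f.map g.map := rfl

theorem whiskerLeft_eq (X : CPM) {Y Y' : CPM} (f : Y ⟶ Y') : X ◁ f = 𝟙 X ⊗ₘ f := rfl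

theorem whiskerRight_eq {Y Y' : CPM} (f : Y ⟶ Y') (X : CPM) : f ▷ X = f ⊗ₘ 𝟙 X := rfl

theorem associator_hom (X Y Z : CPM) :
    (α_ X Y Z).hom = pure (assoc X.toHilb Y.toHilb Z.toHilb) := rfl

theorem leftUnitor_hom (X : CPM) : (λ_ X).hom = pure (lid X.toHilb) := rfl

theorem rightUnitor_hom (X : CPM) : (ρ_ X).hom = pure (rid X.toHilb) := rfl

theorem pure_tensor (f : H →ₗ[ℂ] K) (g : H' →ₗ[ℂ] K') :
    pure f ⊗ₘ pure g = pure (Hyp.map f g) :=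
  hom_ext (doubled_map f g).symm

theorem pure_comp (f : H →ₗ[ℂ] K) (g : K →ₗ[ℂ] L) : pure f ≫ pure g = pure (g ∘ₗ f) :=
  hom_ext (doubled_comp g f).symm

theorem pure_id : 𝟙 (CPM.of H) = pure (LinearMap.id : H →ₗ[ℂ] H) := hom_ext doubled_id.symm

theorem opTensor_id : opTensor (LinearMap.id : Op H →ₗ[ℂ] Op H)
    (LinearMap.id : Op K →ₗ[ℂ] Op K) = LinearMap.id := op_ext fun A B => by simp

theorem doubled_assoc_map (A : Op G) (B : Op H) (C : Op K) :
    doubled (assoc G H K) (Hyp.map (Hyp.map A B) C) = Hyp.map A (Hyp.map B C) := by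
  rw [doubled_apply, dag_assoc]
  exact hext_r fun x y z => rfl

theorem doubled_lid_map (c : Op FdHilb.unit) (A : Op H) :
    doubled (lid H) (Hyp.map c A) = scal (c one) • A := by
  refine LinearMap.ext fun x => ?_
  simp [dag_lid_apply]

theorem doubled_rid_map (c : Op FdHilb.unit) (A : Op H) :
    doubled (rid H) (Hyp.map A c) = scal (c one) • A := by
  refine LinearMap.ext fun x => ?_
  simp [dag_rid_apply]

theorem pentagon_aux (A B C D : FdHilb) :
    (Hyp.map LinearMap.id (assoc B C D) ∘ₗ assoc A (B ⊗ʰ C) D) ∘ₗ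
      Hyp.map (assoc A B C) LinearMap.id = assoc A B (C ⊗ʰ D) ∘ₗ assoc (A ⊗ʰ B) C D := by
  refine hext fun t z => ?_
  have : ((Hyp.map LinearMap.id (assoc B C D) ∘ₗ assoc A (B ⊗ʰ C) D) ∘ₗ
      Hyp.map (assoc A B C) LinearMap.id) ∘ₗ (tm _ _).flip z =
      (assoc A B (C ⊗ʰ D) ∘ₗ assoc (A ⊗ʰ B) C D) ∘ₗ (tm _ _).flip z := hext_l fun x y u => rfl
  exact LinearMap.congr_fun this t

theorem pure_tensor_id (W X Y Z : CPM) : (α_ W X Y).hom ⊗ₘ 𝟙 Z =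
    pure (Hyp.map (assoc W.toHilb X.toHilb Y.toHilb) (LinearMap.id : Z.toHilb →ₗ[ℂ] _)) :=
  hom_ext (by rw [pure_map, doubled_map, doubled_id]; rfl)

theorem id_tensor_pure (W X Y Z : CPM) : 𝟙 W ⊗ₘ (α_ X Y Z).hom =
    pure (Hyp.map (LinearMap.id : W.toHilb →ₗ[ℂ] _) (assoc X.toHilb Y.toHilb Z.toHilb)) :=
  hom_ext (by rw [pure_map, doubled_map, doubled_id]; rfl)

instance : MonoidalCategory CPM :=
  MonoidalCategory.ofTensorHom
    (id_tensorHom_id := fun X Y => hom_ext opTensor_id)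
    (id_tensorHom := fun _ _ _ _ => rfl)
    (tensorHom_id := fun _ _ => rfl)
    (tensorHom_comp_tensorHom := fun f₁ f₂ g₁ g₂ =>
      hom_ext (opTensor_comp f₁.map f₂.map g₁.map g₂.map).symm)
    (associator_naturality := fun f₁ f₂ f₃ => hom_ext (op_ext_l fun A B C => by
      simp only [comp_map, associator_hom, pure_map, tensorHom_map, LinearMap.comp_apply]
      erw [opTensor_map, opTensor_map, doubled_assoc_map, doubled_assoc_map, opTensor_map,
        opTensor_map]))
    (leftUnitor_naturality := fun f => hom_ext (op_ext fun c A => by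
      simp only [comp_map, leftUnitor_hom, pure_map, tensorHom_map, LinearMap.comp_apply]
      erw [opTensor_map, doubled_lid_map, doubled_lid_map, map_smul]
      rfl))
    (rightUnitor_naturality := fun f => hom_ext (op_ext fun A c => by
      simp only [comp_map, rightUnitor_hom, pure_map, tensorHom_map, LinearMap.comp_apply]
      erw [opTensor_map, doubled_rid_map, doubled_rid_map, map_smul]
      rfl))
    (pentagon := fun W X Y Z => by
      rw [pure_tensor_id W X Y Z, id_tensor_pure W X Y Z]
      simp only [associator_hom]
      exact (congrArg (pure _ ≫ ·) (pure_comp _ _)).trans ((pure_comp _ _).trans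
        ((congrArg pure (pentagon_aux _ _ _ _)).trans (pure_comp _ _).symm)))
    (triangle := fun X Y => hom_ext (op_ext_l fun A c B => by
      simp only [comp_map, associator_hom, leftUnitor_hom, rightUnitor_hom, pure_map,
        tensorHom_map, LinearMap.comp_apply, id_map]
      erw [doubled_assoc_map, opTensor_map, opTensor_map, doubled_lid_map, doubled_rid_map]
      simp only [← mapₗ_apply, LinearMap.id_apply, map_smul, LinearMap.smul_apply]))

/-- The discarding map, `ρ ↦ tr ρ`. -/
def discard (X : CPM) : X ⟶ 𝟙_ CPM where
  map := (LinearMap.trace ℂ X.toHilb).smulRight (LinearMap.id : Op FdHilb.unit)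
  isCP := by
    let b := stdOrthonormalBasis ℂ X.toHilb
    refine (isCP_iff _).mpr ⟨_, inferInstance,
      fun i => (innerₛₗ ℂ (b i)).smulRight one, ?_⟩
    refine LinearMap.ext fun ρ => LinearMap.ext fun c => ?_
    have hd : ∀ i (c : FdHilb.unit),
        dag ((innerₛₗ ℂ (b i)).smulRight one) c = scal c • b i := fun i c => by
      refine vec_ext (LinearMap.ext fun v => ?_)
      simp [dag_inner_left, mul_comm]
    refine scal_inj ?_
    simp [LinearMap.trace_eq_sum_inner ρ b, LinearMap.sum_apply, hd, mul_comm, Finset.mul_sum,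
      inner_smul_right]

/-- Preservation of the trace. -/
def IsTracePreserving (f : X ⟶ Y) : Prop :=
  ∀ ρ : Op X.toHilb, LinearMap.trace ℂ Y.toHilb (f.map ρ) = LinearMap.trace ℂ X.toHilb ρ

end CPM

/-! ### The category of density hypercubes -/

/-- The category of density hypercubes; its objects are the density hypercubes `DD(H)` of the
finite-dimensional Hilbert spaces `H`. -/
structure DD where
  of ::
  toHilb : FdHilb

namespace DD

/-- A map of density hypercubes `DD(H) → DD(K)`. -/
@[ext]
structure Hom (X Y : DD) where
  map : Op (X.toHilb ⊗ʰ X.toHilb) →ₗ[ℂ] Op (Y.toHilb ⊗ʰ Y.toHilb)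
  isDD : IsDD map

instance : Category DD where
  Hom := Hom
  id _ := ⟨LinearMap.id, by rw [← doubled_id, ← map_id]; exact isDD_doubled _⟩
  comp f g := ⟨g.map ∘ₗ f.map, g.isDD.comp f.isDD⟩

variable {X Y W : DD}

@[ext]
theorem hom_ext {f g : X ⟶ Y} (h : f.map = g.map) : f = g := Hom.ext h

@[simp] theorem id_map : Hom.map (𝟙 X) = LinearMap.id := rfl

@[simp] theorem comp_map (f : X ⟶ Y) (g : Y ⟶ W) : (f ≫ g).map = g.map ∘ₗ f.map := rfl

/-- The completely positive map underlying a map of density hypercubes. -/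
def Hom.toCP (f : X ⟶ Y) :
    CPM.of (X.toHilb ⊗ʰ X.toHilb) ⟶ CPM.of (Y.toHilb ⊗ʰ Y.toHilb) := ⟨f.map, f.isDD.isCP⟩

/-- The inclusion of density hypercubes into quantum systems, `DD(H) ↦ H ⊗ H`. -/
def toCPM : DD ⥤ CPM where
  obj X := CPM.of (X.toHilb ⊗ʰ X.toHilb)
  map f := f.toCP

instance : toCPM.Faithful where
  map_injective h := hom_ext (congrArg CPM.Hom.map h)

/-- Two copies of the doubling of a linear map. -/
def pure (f : H →ₗ[ℂ] K) : DD.of H ⟶ DD.of K := ⟨doubled (Hyp.map f f), isDD_doubled f⟩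

@[simp] theorem pure_map (f : H →ₗ[ℂ] K) : (pure f).map = doubled (Hyp.map f f) := rfl

/-- Two copies of the doubling of an invertible linear map. -/
@[simps]
def pureIso (f : H →ₗ[ℂ] K) (g : K →ₗ[ℂ] H) (h : g ∘ₗ f = LinearMap.id)
    (h' : f ∘ₗ g = LinearMap.id) : DD.of H ≅ DD.of K where
  hom := pure f
  inv := pure g
  hom_inv_id := hom_ext (by simp [← doubled_comp, ← map_comp, h])
  inv_hom_id := hom_ext (by simp [← doubled_comp, ← map_comp, h'])

/-- The tensor product of maps of density hypercubes. -/
def tensorHom {X X' Y Y' : DD} (f : X ⟶ Y) (g : X' ⟶ Y') :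
    DD.of (X.toHilb ⊗ʰ X'.toHilb) ⟶ DD.of (Y.toHilb ⊗ʰ Y'.toHilb) :=
  ⟨ddTensor f.map g.map, f.isDD.ddTensor g.isDD⟩

instance : MonoidalCategoryStruct DD where
  tensorObj X Y := DD.of (X.toHilb ⊗ʰ Y.toHilb)
  tensorHom f g := tensorHom f g
  whiskerLeft X _ _ f := tensorHom (𝟙 X) f
  whiskerRight f Y := tensorHom f (𝟙 Y)
  tensorUnit := DD.of FdHilb.unit
  associator X Y Z := pureIso (assoc _ _ _) (assocInv X.toHilb Y.toHilb Z.toHilb)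
    (hext_l fun _ _ _ => rfl) (hext_r fun _ _ _ => rfl)
  leftUnitor X := pureIso (lid X.toHilb) (tm _ _ one)
    (hext fun c x => by rw [LinearMap.comp_apply, lid_tm, eq_scal_smul c]; simp)
    (LinearMap.ext fun x => by simp)
  rightUnitor X := pureIso (rid X.toHilb) ((tm _ _).flip one)
    (hext fun x c => by rw [LinearMap.comp_apply, rid_tm, eq_scal_smul c]; simp)
    (LinearMap.ext fun x => by simp)

theorem hext6' {f g : ((A ⊗ʰ B) ⊗ʰ C) ⊗ʰ ((D ⊗ʰ E) ⊗ʰ G) →ₗ[ℂ] M}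
    (h : ∀ a b c d e x, f (((a ⊗ᵗ b) ⊗ᵗ c) ⊗ᵗ ((d ⊗ᵗ e) ⊗ᵗ x)) =
      g (((a ⊗ᵗ b) ⊗ᵗ c) ⊗ᵗ ((d ⊗ᵗ e) ⊗ᵗ x))) : f = g := by
  refine hext fun s t => ?_
  have h1 : ∀ a b c, f ∘ₗ tm _ _ ((a ⊗ᵗ b) ⊗ᵗ c) = g ∘ₗ tm _ _ ((a ⊗ᵗ b) ⊗ᵗ c) :=
    fun a b c => hext_l fun d e x => h a b c d e x
  have h2 : f ∘ₗ (tm _ _).flip t = g ∘ₗ (tm _ _).flip t :=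
    hext_l fun a b c => LinearMap.congr_fun (h1 a b c) t
  exact LinearMap.congr_fun h2 s

/-- The middle interchange relating `(H ⊗ H) ⊗ (K ⊗ K)` with `(H ⊗ K) ⊗ (H ⊗ K)`. -/
def interchange (X Y : DD) : toCPM.obj X ⊗ toCPM.obj Y ≅ toCPM.obj (X ⊗ Y) :=
  CPM.pureIso (swapMid _ _ _ _) (swapMid X.toHilb Y.toHilb X.toHilb Y.toHilb)
    (swapMid_swapMid _ _ _ _) (swapMid_swapMid _ _ _ _)

theorem associator_aux (A B C : FdHilb) :
    Hyp.map (assoc A B C) (assoc A B C) =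
      swapMid A A (B ⊗ʰ C) (B ⊗ʰ C) ∘ₗ Hyp.map LinearMap.id (swapMid B B C C) ∘ₗ
      assoc (A ⊗ʰ A) (B ⊗ʰ B) (C ⊗ʰ C) ∘ₗ Hyp.map (swapMid A B A B) LinearMap.id ∘ₗ
      swapMid (A ⊗ʰ B) C (A ⊗ʰ B) C := hext6' fun _ _ _ _ _ _ => rfl

theorem associator_pure (A B C : FdHilb) :
    CPM.pure (Hyp.map (assoc A B C) (assoc A B C)) =
      (CPM.pure (swapMid (A ⊗ʰ B) C (A ⊗ʰ B) C) ≫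
        CPM.pure (Hyp.map (swapMid A B A B) LinearMap.id)) ≫
      CPM.pure (assoc (A ⊗ʰ A) (B ⊗ʰ B) (C ⊗ʰ C)) ≫
      (CPM.pure (Hyp.map LinearMap.id (swapMid B B C C)) ≫
        CPM.pure (swapMid A A (B ⊗ʰ C) (B ⊗ʰ C))) := by
  rw [associator_aux]
  simp only [CPM.pure_comp, LinearMap.comp_assoc]

theorem pure_tensor_id (f : H →ₗ[ℂ] K) (L : FdHilb) :
    CPM.pure (Hyp.map f (LinearMap.id : L →ₗ[ℂ] L)) = CPM.pure f ⊗ₘ 𝟙 (CPM.of L) :=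
  CPM.hom_ext (by rw [CPM.pure_map, doubled_map, doubled_id]; rfl)

theorem id_tensor_pure (f : H →ₗ[ℂ] K) (L : FdHilb) :
    CPM.pure (Hyp.map (LinearMap.id : L →ₗ[ℂ] L) f) = 𝟙 (CPM.of L) ⊗ₘ CPM.pure f :=
  CPM.hom_ext (by rw [CPM.pure_map, doubled_map, doubled_id]; rfl)

theorem leftUnitor_aux (A : FdHilb) :
    Hyp.map (lid A) (lid A) = lid (A ⊗ʰ A) ∘ₗ Hyp.map (lid FdHilb.unit) LinearMap.id ∘ₗ
      swapMid FdHilb.unit A FdHilb.unit A := hext4 fun c x d y => by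
  simp [smul_smul, mul_comm]

theorem rightUnitor_aux (A : FdHilb) :
    Hyp.map (rid A) (rid A) = rid (A ⊗ʰ A) ∘ₗ Hyp.map LinearMap.id (lid FdHilb.unit) ∘ₗ
      swapMid A FdHilb.unit A FdHilb.unit := hext4 fun x c y d => by
  simp [smul_smul, mul_comm]

/-- The data making the inclusion into quantum systems a monoidal functor. -/
def inducingData : Monoidal.InducingFunctorData toCPM where
  μIso := interchange
  whiskerLeft_eq _ _ _ _ := rfl
  whiskerRight_eq _ _ := rfl
  tensorHom_eq _ _ := rfl
  εIso := (λ_ (CPM.of FdHilb.unit)).symm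
  associator_eq X Y Z := (associator_pure X.toHilb Y.toHilb Z.toHilb).trans
    (congrArg₂ (· ≫ ·) (congrArg (_ ≫ ·) (pure_tensor_id _ _))
      (congrArg (_ ≫ ·) (congrArg (· ≫ _) (id_tensor_pure _ _))))
  leftUnitor_eq X := CPM.hom_ext (by
    refine (congrArg doubled (leftUnitor_aux X.toHilb)).trans ?_
    simp only [doubled_comp, doubled_map, doubled_id]
    rfl)
  rightUnitor_eq X := CPM.hom_ext (by
    refine (congrArg doubled (rightUnitor_aux X.toHilb)).trans ?_
    simp only [doubled_comp, doubled_map, doubled_id]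
    rfl)

instance : MonoidalCategory DD := Monoidal.induced toCPM inducingData

theorem tensorHom_map {X X' Y Y' : DD} (f : X ⟶ Y) (g : X' ⟶ Y') :
    (f ⊗ₘ g).map = ddTensor f.map g.map := rfl

theorem isDD_trace (H : FdHilb) : IsDD (H := H) (K := FdHilb.unit)
    ((LinearMap.trace ℂ (H ⊗ʰ H :)).smulRight LinearMap.id) := by
  let b := stdOrthonormalBasis ℂ H
  have h := isDD_sum fun i => (innerₛₗ ℂ (b i)).smulRight one
  convert h using 1
  have hd : ∀ i (c : FdHilb.unit),
      dag ((innerₛₗ ℂ (b i)).smulRight one) c = scal c • b i := fun i c => by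
    refine vec_ext (LinearMap.ext fun v => ?_)
    simp [dag_inner_left, mul_comm]
  have hi : ∀ i j (t : H ⊗ʰ H), Hyp.map ((innerₛₗ ℂ (b i)).smulRight one)
      ((innerₛₗ ℂ (b j)).smulRight one) t = inner ℂ (b i ⊗ᵗ b j) t • (one ⊗ᵗ one) := by
    intro i j t
    have h1 : Hyp.map ((innerₛₗ ℂ (b i)).smulRight one) ((innerₛₗ ℂ (b j)).smulRight one) =
        (innerₛₗ ℂ (b i ⊗ᵗ b j)).smulRight (one ⊗ᵗ one) := hext fun x y => by
      simp [smul_smul, mul_comm]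
    exact LinearMap.congr_fun h1 t
  refine LinearMap.ext fun ρ => hext fun c d => ?_
  rw [eq_scal_smul c, eq_scal_smul d]
  simp only [LinearMap.trace_eq_sum_inner ρ (prodB b b), LinearMap.sum_apply, doubled_apply,
    LinearMap.comp_apply, dag_map, map_tm, hd, hi, prodB_apply, LinearMap.smulRight_apply,
    Finset.sum_smul, map_smul, LinearMap.smul_apply, LinearMap.id_apply, scal_one, one_smul,
    Finset.smul_sum]

/-- The discarding map of density hypercubes, which discards both copies of the doubled
system: `ρ ↦ tr ρ` on operators on `H ⊗ H`. -/
def discard (X : DD) : X ⟶ 𝟙_ DD where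
  map := (LinearMap.trace ℂ (X.toHilb ⊗ʰ X.toHilb :)).smulRight
    (LinearMap.id : Op (FdHilb.unit ⊗ʰ FdHilb.unit))
  isDD := isDD_trace X.toHilb

end DD

/-! ### The monoidal structure of the Karoubi envelope -/

section Karoubi

open Idempotents

universe v u

variable {C₀ : Type u} [Category.{v} C₀] [MonoidalCategory C₀]

instance : MonoidalCategoryStruct (Karoubi C₀) where
  tensorObj P Q := ⟨P.X ⊗ Q.X, P.p ⊗ₘ Q.p, by rw [tensorHom_comp_tensorHom, P.idem, Q.idem]⟩
  tensorHom f g := ⟨f.f ⊗ₘ g.f, by simp only [tensorHom_comp_tensorHom, f.comm, g.comm]⟩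
  whiskerLeft P _ _ f := ⟨P.p ⊗ₘ f.f, by simp only [tensorHom_comp_tensorHom, P.idem, f.comm]⟩
  whiskerRight f P := ⟨f.f ⊗ₘ P.p, by simp only [tensorHom_comp_tensorHom, P.idem, f.comm]⟩
  tensorUnit := ⟨𝟙_ C₀, 𝟙 _, Category.comp_id _⟩
  associator P Q R :=
    { hom := ⟨((P.p ⊗ₘ Q.p) ⊗ₘ R.p) ≫ (α_ P.X Q.X R.X).hom, by
        simp only [Category.assoc, ← associator_naturality]
        simp only [← Category.assoc, tensorHom_comp_tensorHom, P.idem, Q.idem, R.idem]⟩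
      inv := ⟨(P.p ⊗ₘ (Q.p ⊗ₘ R.p)) ≫ (α_ P.X Q.X R.X).inv, by
        simp only [Category.assoc, ← associator_inv_naturality]
        simp only [← Category.assoc, tensorHom_comp_tensorHom, P.idem, Q.idem, R.idem]⟩
      hom_inv_id := Karoubi.hom_ext _ _ (by
        simp only [Karoubi.comp_f, Karoubi.id_f, Category.assoc, associator_inv_naturality,
          Iso.hom_inv_id_assoc, tensorHom_comp_tensorHom, P.idem, Q.idem, R.idem])
      inv_hom_id := Karoubi.hom_ext _ _ (by
        simp only [Karoubi.comp_f, Karoubi.id_f, Category.assoc, associator_naturality,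
          Iso.inv_hom_id_assoc, tensorHom_comp_tensorHom, P.idem, Q.idem, R.idem]) }
  leftUnitor P :=
    { hom := ⟨(𝟙 _ ⊗ₘ P.p) ≫ (λ_ P.X).hom, by simp⟩
      inv := ⟨P.p ≫ (λ_ P.X).inv, by simp⟩
      hom_inv_id := Karoubi.hom_ext _ _ (by simp)
      inv_hom_id := Karoubi.hom_ext _ _ (by simp) }
  rightUnitor P :=
    { hom := ⟨(P.p ⊗ₘ 𝟙 _) ≫ (ρ_ P.X).hom, by simp⟩
      inv := ⟨P.p ≫ (ρ_ P.X).inv, by simp⟩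
      hom_inv_id := Karoubi.hom_ext _ _ (by simp)
      inv_hom_id := Karoubi.hom_ext _ _ (by simp) }

theorem karoubi_tensor_p (P Q : Karoubi C₀) : (P ⊗ Q).p = P.p ⊗ₘ Q.p := rfl

theorem karoubi_tensorHom_f {P Q P' Q' : Karoubi C₀} (f : P ⟶ Q) (g : P' ⟶ Q') :
    (f ⊗ₘ g).f = f.f ⊗ₘ g.f := rfl

theorem karoubi_associator_f (P Q R : Karoubi C₀) :
    (α_ P Q R).hom.f = ((P.p ⊗ₘ Q.p) ⊗ₘ R.p) ≫ (α_ P.X Q.X R.X).hom := rfl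

theorem karoubi_leftUnitor_f (P : Karoubi C₀) :
    (λ_ P).hom.f = (𝟙 _ ⊗ₘ P.p) ≫ (λ_ P.X).hom := rfl

theorem karoubi_rightUnitor_f (P : Karoubi C₀) :
    (ρ_ P).hom.f = (P.p ⊗ₘ 𝟙 _) ≫ (ρ_ P.X).hom := rfl

/-- The monoidal structure of the Karoubi envelope of a monoidal category. -/
instance : MonoidalCategory (Karoubi C₀) :=
  MonoidalCategory.ofTensorHom
    (id_tensorHom_id := fun _ _ => rfl)
    (id_tensorHom := fun _ _ _ _ => rfl)
    (tensorHom_id := fun _ _ => rfl)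
    (tensorHom_comp_tensorHom := fun f₁ f₂ g₁ g₂ =>
      Karoubi.hom_ext _ _ (tensorHom_comp_tensorHom f₁.f f₂.f g₁.f g₂.f))
    (associator_naturality := fun f₁ f₂ f₃ => Karoubi.hom_ext _ _ (by
      change ((f₁.f ⊗ₘ f₂.f) ⊗ₘ f₃.f) ≫ ((_ ⊗ₘ _) ⊗ₘ _) ≫ _ =
        (((_ ⊗ₘ _) ⊗ₘ _) ≫ _) ≫ (f₁.f ⊗ₘ f₂.f ⊗ₘ f₃.f)
      rw [Category.assoc, ← associator_naturality]
      simp only [← Category.assoc, tensorHom_comp_tensorHom, Karoubi.p_comp, Karoubi.comp_p]))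
    (leftUnitor_naturality := fun f => Karoubi.hom_ext _ _ (by
      change (𝟙 (𝟙_ C₀) ⊗ₘ f.f) ≫ (𝟙 (𝟙_ C₀) ⊗ₘ _) ≫ _ = ((𝟙 (𝟙_ C₀) ⊗ₘ _) ≫ _) ≫ f.f
      simp))
    (rightUnitor_naturality := fun f => Karoubi.hom_ext _ _ (by
      change (f.f ⊗ₘ 𝟙 (𝟙_ C₀)) ≫ (_ ⊗ₘ 𝟙 (𝟙_ C₀)) ≫ _ = ((_ ⊗ₘ 𝟙 (𝟙_ C₀)) ≫ _) ≫ f.f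
      simp))
    (pentagon := fun W X Y Z => Karoubi.hom_ext _ _ (by
      change ((((W.p ⊗ₘ X.p) ⊗ₘ Y.p) ≫ (α_ W.X X.X Y.X).hom) ⊗ₘ Z.p) ≫
        (((W.p ⊗ₘ (X.p ⊗ₘ Y.p)) ⊗ₘ Z.p) ≫ (α_ W.X (X.X ⊗ Y.X) Z.X).hom) ≫
        (W.p ⊗ₘ (((X.p ⊗ₘ Y.p) ⊗ₘ Z.p) ≫ (α_ X.X Y.X Z.X).hom)) =
        ((((W.p ⊗ₘ X.p) ⊗ₘ Y.p) ⊗ₘ Z.p) ≫ (α_ (W.X ⊗ X.X) Y.X Z.X).hom) ≫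
        (((W.p ⊗ₘ X.p) ⊗ₘ (Y.p ⊗ₘ Z.p)) ≫ (α_ W.X X.X (Y.X ⊗ Z.X)).hom)
      have e1 : (((W.p ⊗ₘ X.p) ⊗ₘ Y.p) ≫ (α_ W.X X.X Y.X).hom) ⊗ₘ Z.p =
          (((W.p ⊗ₘ X.p) ⊗ₘ Y.p) ⊗ₘ Z.p) ≫ ((α_ W.X X.X Y.X).hom ⊗ₘ 𝟙 Z.X) := by
        rw [tensorHom_comp_tensorHom, Category.comp_id]
      have e2 : W.p ⊗ₘ (((X.p ⊗ₘ Y.p) ⊗ₘ Z.p) ≫ (α_ X.X Y.X Z.X).hom) =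
          (W.p ⊗ₘ ((X.p ⊗ₘ Y.p) ⊗ₘ Z.p)) ≫ (𝟙 W.X ⊗ₘ (α_ X.X Y.X Z.X).hom) := by
        rw [tensorHom_comp_tensorHom, Category.comp_id]
      have e3 : ((α_ W.X X.X Y.X).hom ⊗ₘ 𝟙 Z.X) ≫ ((W.p ⊗ₘ (X.p ⊗ₘ Y.p)) ⊗ₘ Z.p) =
          (((W.p ⊗ₘ X.p) ⊗ₘ Y.p) ⊗ₘ Z.p) ≫ ((α_ W.X X.X Y.X).hom ⊗ₘ 𝟙 Z.X) := by
        rw [tensorHom_comp_tensorHom, tensorHom_comp_tensorHom, associator_naturality,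
          Category.comp_id, Category.id_comp]
      have e4 : (α_ W.X (X.X ⊗ Y.X) Z.X).hom ≫ (W.p ⊗ₘ ((X.p ⊗ₘ Y.p) ⊗ₘ Z.p)) =
          ((W.p ⊗ₘ (X.p ⊗ₘ Y.p)) ⊗ₘ Z.p) ≫ (α_ W.X (X.X ⊗ Y.X) Z.X).hom :=
        (associator_naturality _ _ _).symm
      have e5 : (α_ (W.X ⊗ X.X) Y.X Z.X).hom ≫ ((W.p ⊗ₘ X.p) ⊗ₘ (Y.p ⊗ₘ Z.p)) =
          (((W.p ⊗ₘ X.p) ⊗ₘ Y.p) ⊗ₘ Z.p) ≫ (α_ (W.X ⊗ X.X) Y.X Z.X).hom :=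
        (associator_naturality _ _ _).symm
      have e6 : (((W.p ⊗ₘ X.p) ⊗ₘ Y.p) ⊗ₘ Z.p) ≫ (((W.p ⊗ₘ X.p) ⊗ₘ Y.p) ⊗ₘ Z.p) =
          (((W.p ⊗ₘ X.p) ⊗ₘ Y.p) ⊗ₘ Z.p) := by
        simp only [tensorHom_comp_tensorHom, Karoubi.idem]
      have e7 := pentagon W.X X.X Y.X Z.X
      rw [← tensorHom_id, ← id_tensorHom] at e7
      rw [e1, e2]
      simp only [Category.assoc]
      rw [reassoc_of% e4, reassoc_of% e5, reassoc_of% e3, reassoc_of% e3, reassoc_of% e6,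
        reassoc_of% e6, reassoc_of% e6, e7]))
    (triangle := fun X Y => Karoubi.hom_ext _ _ (by
      change (((X.p ⊗ₘ 𝟙 _) ⊗ₘ Y.p) ≫ (α_ X.X (𝟙_ C₀) Y.X).hom) ≫
        (X.p ⊗ₘ ((𝟙 _ ⊗ₘ Y.p) ≫ (λ_ Y.X).hom)) = ((X.p ⊗ₘ 𝟙 _) ≫ (ρ_ X.X).hom) ⊗ₘ Y.p
      have e1 : X.p ⊗ₘ ((𝟙 (𝟙_ C₀) ⊗ₘ Y.p) ≫ (λ_ Y.X).hom) =
          (X.p ⊗ₘ (𝟙 _ ⊗ₘ Y.p)) ≫ (𝟙 _ ⊗ₘ (λ_ Y.X).hom) := by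
        rw [tensorHom_comp_tensorHom, Category.comp_id]
      have e2 := triangle X.X Y.X
      rw [← tensorHom_id, ← id_tensorHom] at e2
      rw [e1, Category.assoc, ← associator_naturality_assoc, e2]
      simp only [tensorHom_comp_tensorHom, Karoubi.idem, Category.comp_id]
      rw [← Category.assoc, tensorHom_comp_tensorHom, X.idem, Category.comp_id]))

end Karoubi

/-! ### Quantum systems in the Karoubi envelope -/

open Idempotents

/-- The hyper-decoherence map of a classical structure on `H`: the doubling of the multiplication
followed by the comultiplication. -/
def hyperDecoherence (Z : ClassicalStructure H) : DD.of H ⟶ DD.of H where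
  map := doubled (Z.comul ∘ₗ Z.mul)
  isDD := (isDD_iff _).mpr ⟨Unit, inferInstance, H, Z, fun _ => Z.comul, by
    simp [Z.contract_comul]⟩

@[simp]
theorem hyperDecoherence_map (Z : ClassicalStructure H) :
    (hyperDecoherence Z).map = doubled (Z.comul ∘ₗ Z.mul) := rfl

theorem hyperDecoherence_idem (Z : ClassicalStructure H) :
    hyperDecoherence Z ≫ hyperDecoherence Z = hyperDecoherence Z := by
  refine DD.hom_ext ?_
  rw [DD.comp_map, hyperDecoherence_map, ← doubled_comp, LinearMap.comp_assoc,
    ← LinearMap.comp_assoc Z.mul, ClassicalStructure.comul, Z.special, LinearMap.id_comp]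

theorem hyperDecoherence_tensor (Z : ClassicalStructure H) (W : ClassicalStructure K) :
    hyperDecoherence (Z.tensor W) = hyperDecoherence Z ⊗ₘ hyperDecoherence W := by
  refine DD.hom_ext ?_
  rw [DD.tensorHom_map, hyperDecoherence_map, hyperDecoherence_map, hyperDecoherence_map]
  rw [ddTensor, ← doubled_map, ← doubled_comp, ← doubled_comp, map_comp]
  congr 1
  rw [ClassicalStructure.comul, ClassicalStructure.tensor, ClassicalStructure.dag_tensor_mul]
  simp only [LinearMap.comp_assoc]

theorem hyperDecoherence_trivial :
    hyperDecoherence ClassicalStructure.trivial = 𝟙 (DD.of FdHilb.unit) := by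
  refine DD.hom_ext ?_
  have h : ClassicalStructure.trivial.comul ∘ₗ ClassicalStructure.trivial.mul =
      LinearMap.id := by
    refine hext fun c d => ?_
    change dag (lid FdHilb.unit) (lid FdHilb.unit (c ⊗ᵗ d)) = c ⊗ᵗ d
    rw [dag_lid_apply, lid_tm, eq_scal_smul c]
    simp
  rw [hyperDecoherence_map, h, doubled_id]
  rfl

/-- The property of being of the form `(DD(H), hyp)`, where `hyp` is the hyper-decoherence map
of a classical structure on `H`. -/
def isQuantum : ObjectProperty (Karoubi DD) := fun X =>
  ∃ Z : ClassicalStructure X.X.toHilb, X.p = hyperDecoherence Z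

instance : isQuantum.IsMonoidal where
  prop_unit := ⟨ClassicalStructure.trivial, hyperDecoherence_trivial.symm⟩
  prop_tensor := by
    rintro X Y ⟨Z, hZ⟩ ⟨W, hW⟩
    exact ⟨Z.tensor W, by
      rw [karoubi_tensor_p, hZ, hW]
      exact (hyperDecoherence_tensor Z W).symm⟩

/-- The full subcategory of the Karoubi envelope of the category of density hypercubes on the
objects `(DD(H), hyp)`. -/
abbrev QuantumSubcat : Type 1 := isQuantum.FullSubcategory

/-- The object `(DD(H), hyp)` given by a classical structure on `H`. -/
def quantumObj (H : FdHilb) (Z : ClassicalStructure H) : QuantumSubcat :=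
  ⟨⟨DD.of H, hyperDecoherence Z, hyperDecoherence_idem Z⟩, Z, rfl⟩

/-- The discarding map of `(DD(H), hyp)`: the map `hyp` followed by the discarding map
of `DD(H)`. -/
def discardQ (X : QuantumSubcat) : X ⟶ 𝟙_ QuantumSubcat :=
  ObjectProperty.homMk
    (⟨X.obj.p ≫ DD.discard X.obj.X, by
      change X.obj.p ≫ (X.obj.p ≫ DD.discard X.obj.X) ≫ 𝟙 (𝟙_ DD) = _
      rw [Category.comp_id, Karoubi.idem_assoc]⟩ : X.obj ⟶ 𝟙_ (Karoubi DD))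

/-- Normalisation with respect to the discarding maps. -/
def IsNormalised {X Y : QuantumSubcat} (f : X ⟶ Y) : Prop := f ≫ discardQ Y = discardQ X

/-- The tree-on-a-bridge effect of a classical structure on `H`: the doubled multiplication,
followed by the discarding of its output `H`. -/
def treeOnBridge (Z : ClassicalStructure H) :
    CPM.of (H ⊗ʰ H) ⟶ CPM.of (FdHilb.unit ⊗ʰ FdHilb.unit) :=
  CPM.pure Z.mul ≫ CPM.discard (CPM.of H) ≫ (λ_ (𝟙_ CPM)).inv

/-! ### Linearity over the nonnegative reals -/

/-- A category whose sets of morphisms are modules over the nonnegative reals, with bilinear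
composition. -/
class RPlusEnriched (C : Type*) [Category C] where
  addCommMonoid : ∀ X Y : C, AddCommMonoid (X ⟶ Y)
  module : ∀ X Y : C, Module ℝ≥0 (X ⟶ Y)
  add_comp : ∀ {X Y Z : C} (f f' : X ⟶ Y) (g : Y ⟶ Z), (f + f') ≫ g = f ≫ g + f' ≫ g
  comp_add : ∀ {X Y Z : C} (f : X ⟶ Y) (g g' : Y ⟶ Z), f ≫ (g + g') = f ≫ g + f ≫ g'
  smul_comp : ∀ {X Y Z : C} (c : ℝ≥0) (f : X ⟶ Y) (g : Y ⟶ Z), (c • f) ≫ g = c • (f ≫ g)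
  comp_smul : ∀ {X Y Z : C} (f : X ⟶ Y) (c : ℝ≥0) (g : Y ⟶ Z), f ≫ (c • g) = c • (f ≫ g)

attribute [reducible, instance] RPlusEnriched.addCommMonoid RPlusEnriched.module

/-- Linearity over the nonnegative reals of a functor, on morphisms. -/
structure IsRPlusLinear {C₁ C₂ : Type*} [Category C₁] [Category C₂] [RPlusEnriched C₁]
    [RPlusEnriched C₂] (F : C₁ ⥤ C₂) : Prop where
  map_add : ∀ {X Y : C₁} (f g : X ⟶ Y), F.map (f + g) = F.map f + F.map g
  map_smul : ∀ {X Y : C₁} (c : ℝ≥0) (f : X ⟶ Y), F.map (c • f) = c • F.map f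

instance (X Y : CPM) : Zero (X ⟶ Y) := ⟨⟨0, isCP_zero⟩⟩
instance (X Y : CPM) : Add (X ⟶ Y) := ⟨fun f g => ⟨f.map + g.map, f.isCP.add g.isCP⟩⟩
instance (X Y : CPM) : SMul ℝ≥0 (X ⟶ Y) := ⟨fun c f => ⟨c • f.map, f.isCP.smul c⟩⟩
instance (X Y : CPM) : SMul ℕ (X ⟶ Y) := ⟨fun n f => ⟨(n : ℝ≥0) • f.map, f.isCP.smul n⟩⟩

theorem natCast_smul (n : ℕ) (Φ : Op H →ₗ[ℂ] Op K) : (n : ℝ≥0) • Φ = n • Φ :=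
  Nat.cast_smul_eq_nsmul ℝ≥0 n Φ

instance (X Y : CPM) : AddCommMonoid (X ⟶ Y) :=
  Function.Injective.addCommMonoid (fun f : X ⟶ Y => f.map) (fun _ _ => CPM.hom_ext) rfl
    (fun _ _ => rfl) (fun f n => natCast_smul n f.map)

/-- The linear map underlying a completely positive map, additively. -/
def CPM.mapAddHom (X Y : CPM) : (X ⟶ Y) →+ (Op X.toHilb →ₗ[ℂ] Op Y.toHilb) where
  toFun f := f.map
  map_zero' := rfl
  map_add' _ _ := rfl

/-- Sums and nonnegative multiples of completely positive maps. -/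
instance : RPlusEnriched CPM where
  addCommMonoid X Y := inferInstance
  module X Y := Function.Injective.module ℝ≥0 (CPM.mapAddHom X Y) (fun _ _ => CPM.hom_ext)
    (fun _ _ => rfl)
  add_comp f f' g := CPM.hom_ext (LinearMap.comp_add _ _ _)
  comp_add f g g' := CPM.hom_ext (LinearMap.add_comp _ _ _)
  smul_comp c f g := CPM.hom_ext (by
    change g.map ∘ₗ (c • f.map) = c • (g.map ∘ₗ f.map)
    rw [nnreal_smul, nnreal_smul, LinearMap.comp_smul])
  comp_smul f c g := CPM.hom_ext (LinearMap.smul_comp _ _ _)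

instance (X Y : DD) : Zero (X ⟶ Y) := ⟨⟨0, isDD_zero⟩⟩
instance (X Y : DD) : Add (X ⟶ Y) := ⟨fun f g => ⟨f.map + g.map, f.isDD.add g.isDD⟩⟩
instance (X Y : DD) : SMul ℝ≥0 (X ⟶ Y) := ⟨fun c f => ⟨c • f.map, f.isDD.smul c⟩⟩
instance (X Y : DD) : SMul ℕ (X ⟶ Y) := ⟨fun n f => ⟨(n : ℝ≥0) • f.map, f.isDD.smul n⟩⟩

instance (X Y : DD) : AddCommMonoid (X ⟶ Y) :=
  Function.Injective.addCommMonoid (fun f : X ⟶ Y => f.map) (fun _ _ => DD.hom_ext) rfl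
    (fun _ _ => rfl) (fun f n => natCast_smul n f.map)

/-- The linear map underlying a map of density hypercubes, additively. -/
def DD.mapAddHom (X Y : DD) :
    (X ⟶ Y) →+ (Op (X.toHilb ⊗ʰ X.toHilb) →ₗ[ℂ] Op (Y.toHilb ⊗ʰ Y.toHilb)) where
  toFun f := f.map
  map_zero' := rfl
  map_add' _ _ := rfl

/-- Sums and nonnegative multiples of maps of density hypercubes. -/
instance : RPlusEnriched DD where
  addCommMonoid X Y := inferInstance
  module X Y := Function.Injective.module ℝ≥0 (DD.mapAddHom X Y) (fun _ _ => DD.hom_ext)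
    (fun _ _ => rfl)
  add_comp f f' g := DD.hom_ext (LinearMap.comp_add _ _ _)
  comp_add f g g' := DD.hom_ext (LinearMap.add_comp _ _ _)
  smul_comp c f g := DD.hom_ext (by
    change g.map ∘ₗ (c • f.map) = c • (g.map ∘ₗ f.map)
    rw [nnreal_smul, nnreal_smul, LinearMap.comp_smul])
  comp_smul f c g := DD.hom_ext (LinearMap.smul_comp _ _ _)

section Enriched

variable {C₀ : Type*} [Category C₀] [RPlusEnriched C₀]

open RPlusEnriched

theorem zero_comp' {X Y Z : C₀} (g : Y ⟶ Z) : (0 : X ⟶ Y) ≫ g = 0 := by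
  rw [← zero_smul ℝ≥0 (0 : X ⟶ Y), smul_comp, zero_smul]

theorem comp_zero' {X Y Z : C₀} (f : X ⟶ Y) : f ≫ (0 : Y ⟶ Z) = 0 := by
  rw [← zero_smul ℝ≥0 (0 : Y ⟶ Z), comp_smul, zero_smul]

instance (P Q : Karoubi C₀) : Zero (P ⟶ Q) := ⟨⟨0, by rw [zero_comp', comp_zero']⟩⟩
instance (P Q : Karoubi C₀) : Add (P ⟶ Q) :=
  ⟨fun f g => ⟨f.f + g.f, by rw [add_comp, comp_add, f.comm, g.comm]⟩⟩
instance (P Q : Karoubi C₀) : SMul ℝ≥0 (P ⟶ Q) :=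
  ⟨fun c f => ⟨c • f.f, by rw [smul_comp, comp_smul, f.comm]⟩⟩
instance (P Q : Karoubi C₀) : SMul ℕ (P ⟶ Q) :=
  ⟨fun n f => ⟨(n : ℝ≥0) • f.f, by rw [smul_comp, comp_smul, f.comm]⟩⟩

instance (P Q : Karoubi C₀) : AddCommMonoid (P ⟶ Q) :=
  Function.Injective.addCommMonoid (fun f : P ⟶ Q => f.f) (fun _ _ => Karoubi.hom_ext _ _) rfl
    (fun _ _ => rfl) (fun f n => Nat.cast_smul_eq_nsmul ℝ≥0 n f.f)

/-- The underlying morphism of a morphism of the Karoubi envelope, additively. -/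
def karoubiAddHom (P Q : Karoubi C₀) : (P ⟶ Q) →+ (P.X ⟶ Q.X) where
  toFun f := f.f
  map_zero' := rfl
  map_add' _ _ := rfl

/-- Sums and nonnegative multiples in the Karoubi envelope. -/
instance : RPlusEnriched (Karoubi C₀) where
  addCommMonoid P Q := inferInstance
  module P Q := Function.Injective.module ℝ≥0 (karoubiAddHom P Q)
    (fun _ _ => Karoubi.hom_ext _ _) (fun _ _ => rfl)
  add_comp f f' g := Karoubi.hom_ext _ _ (add_comp f.f f'.f g.f)
  comp_add f g g' := Karoubi.hom_ext _ _ (comp_add f.f g.f g'.f)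
  smul_comp c f g := Karoubi.hom_ext _ _ (smul_comp c f.f g.f)
  comp_smul f c g := Karoubi.hom_ext _ _ (comp_smul f.f c g.f)

variable (P : ObjectProperty C₀)

/-- The morphisms of a full subcategory. -/
def fullEquiv (X Y : P.FullSubcategory) : (X ⟶ Y) ≃ (X.obj ⟶ Y.obj) where
  toFun f := f.hom
  invFun f := ObjectProperty.homMk f
  left_inv _ := rfl
  right_inv _ := rfl

/-- Sums and nonnegative multiples in a full subcategory. -/
instance : RPlusEnriched P.FullSubcategory where
  addCommMonoid X Y := (fullEquiv P X Y).addCommMonoid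
  module X Y :=
    letI := (fullEquiv P X Y).addCommMonoid
    (fullEquiv P X Y).module ℝ≥0
  add_comp f f' g := ObjectProperty.hom_ext _ (add_comp f.hom f'.hom g.hom)
  comp_add f g g' := ObjectProperty.hom_ext _ (comp_add f.hom g.hom g'.hom)
  smul_comp c f g := ObjectProperty.hom_ext _ (smul_comp c f.hom g.hom)
  comp_smul f c g := ObjectProperty.hom_ext _ (comp_smul f.hom c g.hom)

end Enriched

end Hyp

end

/-! Write `f̂` for the doubling of `f`, and let `μ`, `δ = μ†` be the multiplication and
comultiplication of a classical structure. The hyper-decoherence map is `δ̂ ∘ μ̂`, and speciality `μ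
∘ δ = id` gives `μ̂ ∘ δ̂ = id`. Hence, after the faithful monoidal inclusion `DD(H) ↦ H ⊗ H` into CP
maps, this idempotent splits through the quantum system `H` itself, with section `δ̂` and retraction
`μ̂`. The functor `toQuantum` sends `(DD(H), hyp)` to `H` and a map `f` to `μ̂ ∘ f ∘ δ̂`.
Faithfulness and the monoidal structure are formal consequences of the splittings
(`KaroubiSplitting`). Essential surjectivity holds because every `H` has an orthonormal basis, hence
a classical structure.

The substance is fullness: for every CP map `Φ` the map `δ̂ ∘ Φ ∘ μ̂` must be a map of density
hypercubes (`IsCP.isDD_lift`). Each classical structure is diagonal in an orthonormal basis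
(`ClassicalStructure.exists_basis`): left multiplications commute, and by the Frobenius law their
adjoints are again left multiplications, so they are diagonalised simultaneously. In such bases `δ ∘
k ∘ μ` sends `b z ⊗ b z'` to zero unless `z = z'`, and `b z ⊗ b z` to a combination of the vectors
`w y ⊗ w y`. A bridge between two copies of one map produces exactly this: each copy emits a label
recording the Kraus index, the input `z` and the output `y`, and the bridge forces the two labels to
agree (`exists_contract_eq`). The Kraus index in the label removes the cross terms between different
Kraus operators.

The statement on traces uses `μ ∘ δ = id` again: by cyclicity `tr (δ̂ ρ) = tr ρ`, so discarding
after hyper-decoherence is `tr ∘ μ̂`. Normalisation of `f` thus reads `tr ∘ μ̂ ∘ f = tr ∘ μ̂`, which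
is preservation of the trace by `μ̂ ∘ f ∘ δ̂`. -/

noncomputable section

namespace Hyp

/-! ### Functors out of Karoubi envelopes given by splittings -/

section Splitting

open Idempotents Functor.LaxMonoidal Functor.OplaxMonoidal

variable {D₀ C₀ : Type*} [Category D₀] [Category C₀]

/-- A presentation of a functor `F` on a full subcategory of the Karoubi envelope of `D₀` by
splittings of the images of the idempotents under a functor `T : D₀ ⥤ C₀`. -/
structure KaroubiSplitting (T : D₀ ⥤ C₀) {P : ObjectProperty (Karoubi D₀)}
    (F : P.FullSubcategory ⥤ C₀) where
  s : ∀ X, F.obj X ⟶ T.obj X.obj.X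
  r : ∀ X, T.obj X.obj.X ⟶ F.obj X
  s_r : ∀ X, s X ≫ r X = 𝟙 _
  r_s : ∀ X, r X ≫ s X = T.map X.obj.p
  map_eq : ∀ {X Y} (f : X ⟶ Y), F.map f = s X ≫ T.map f.hom.f ≫ r Y

namespace KaroubiSplitting

variable {T : D₀ ⥤ C₀} {P : ObjectProperty (Karoubi D₀)} {F : P.FullSubcategory ⥤ C₀}
  (S : KaroubiSplitting T F)

theorem s_map_p (X : P.FullSubcategory) : S.s X ≫ T.map X.obj.p = S.s X := by
  rw [← S.r_s, reassoc_of% S.s_r]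

theorem map_p_r (X : P.FullSubcategory) : T.map X.obj.p ≫ S.r X = S.r X := by
  rw [← S.r_s, Category.assoc, S.s_r, Category.comp_id]

/-- Substituting `map_eq`, the two composites `r ≫ s` become the idempotents at both ends, and a
morphism of the Karoubi envelope absorbs these. So `F.map f` determines `T.map f`; faithfulness and
all the naturality statements below rest on this. -/
theorem r_map_s {X Y : P.FullSubcategory} (f : X ⟶ Y) :
    S.r X ≫ F.map f ≫ S.s Y = T.map f.hom.f := by
  rw [S.map_eq]
  simp only [Category.assoc]
  rw [reassoc_of% S.r_s, S.r_s, ← T.map_comp, ← T.map_comp, Karoubi.comp_p, Karoubi.p_comp]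

theorem s_map {X Y : P.FullSubcategory} (f : X ⟶ Y) :
    S.s X ≫ T.map f.hom.f = F.map f ≫ S.s Y := by
  rw [← S.r_map_s, reassoc_of% S.s_r]

theorem map_r {X Y : P.FullSubcategory} (f : X ⟶ Y) :
    T.map f.hom.f ≫ S.r Y = S.r X ≫ F.map f := by
  rw [← S.r_map_s]
  simp only [Category.assoc, S.s_r, Category.comp_id]

theorem faithful (S : KaroubiSplitting T F) [T.Faithful] : F.Faithful where
  map_injective {X Y} f g h := by
    refine ObjectProperty.hom_ext _ (Karoubi.hom_ext _ _ (T.map_injective ?_))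
    rw [← S.r_map_s, ← S.r_map_s, h]

/-- Fullness of a functor given by splittings, when the maps between split idempotents lift
along `T`. -/
theorem full [T.Faithful] (h : ∀ {X Y : P.FullSubcategory} (g : F.obj X ⟶ F.obj Y),
    ∃ f : X.obj.X ⟶ Y.obj.X, T.map f = S.r X ≫ g ≫ S.s Y) : F.Full where
  map_surjective {X Y} g := by
    obtain ⟨f, hf⟩ := h g
    -- The lift is automatically a morphism of the Karoubi envelope: the required invariance under
    -- the idempotents can be tested after the faithful `T`, where `r` and `s` absorb them.
    refine ⟨ObjectProperty.homMk ⟨f, T.map_injective ?_⟩, ?_⟩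
    · rw [T.map_comp, T.map_comp, hf]
      simp only [Category.assoc]
      rw [S.s_map_p, reassoc_of% S.map_p_r]
    · rw [S.map_eq]
      change S.s X ≫ T.map f ≫ S.r Y = g
      rw [hf]
      simp only [Category.assoc, S.s_r, Category.comp_id]
      rw [reassoc_of% S.s_r]

/-! ### Monoidal structure transported along splittings -/

section Monoidal

variable [MonoidalCategory D₀] [MonoidalCategory C₀] [T.Monoidal] [P.IsMonoidal]

/-- The idempotent of a tensor product is the tensor product of the idempotents, so this is
naturality of the tensorator of `T`, with the tensorator cancelled. -/
theorem map_tensor_p (X Y : P.FullSubcategory) :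
    T.map (X ⊗ Y).obj.p = δ T _ _ ≫ (T.map X.obj.p ⊗ₘ T.map Y.obj.p) ≫ μ T _ _ := by
  rw [Functor.LaxMonoidal.μ_natural, Functor.Monoidal.δ_μ_assoc]
  rfl

/-- The tensorator of a functor given by splittings. -/
def tensorIso (X Y : P.FullSubcategory) : F.obj X ⊗ F.obj Y ≅ F.obj (X ⊗ Y) where
  hom := (S.s X ⊗ₘ S.s Y) ≫ μ T _ _ ≫ S.r (X ⊗ Y)
  inv := S.s (X ⊗ Y) ≫ δ T _ _ ≫ (S.r X ⊗ₘ S.r Y)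
  hom_inv_id := by
    simp only [Category.assoc]
    -- The middle `r ≫ s` is the idempotent of `X ⊗ Y`; conjugated by the tensorator it splits into
    -- the two factors, each of which is absorbed by its retraction.
    rw [reassoc_of% S.r_s, map_tensor_p]
    simp only [Category.assoc, Functor.Monoidal.μ_δ_assoc, tensorHom_comp_tensorHom,
      S.map_p_r, S.s_r, id_tensorHom_id]
  inv_hom_id := by
    simp only [Category.assoc, tensorHom_comp_tensorHom_assoc, S.r_s]
    have h := map_tensor_p (T := T) X Y
    rw [← reassoc_of% h, S.map_p_r, S.s_r]

/-- The unit comparison of a functor given by splittings. -/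
def unitIso : 𝟙_ C₀ ≅ F.obj (𝟙_ P.FullSubcategory) where
  hom := ε T ≫ S.r (𝟙_ _)
  inv := S.s (𝟙_ _) ≫ η T
  hom_inv_id := by
    simp only [Category.assoc]
    rw [reassoc_of% S.r_s]
    -- The tensor unit of the Karoubi envelope carries the identity as its idempotent.
    change ε T ≫ T.map (𝟙 _) ≫ η T = _
    simp
  inv_hom_id := by
    simp only [Category.assoc, Functor.Monoidal.η_ε_assoc]
    exact S.s_r _

/-- Sections and retractions are natural (`s_map`, `map_r`), so naturality is inherited from the
tensorator of `T`. The one-sided forms are the cases where one of the maps is an identity. -/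
theorem tensorHom_map_tensorIso {X Y X' Y' : P.FullSubcategory} (f : X ⟶ Y) (g : X' ⟶ Y') :
    (F.map f ⊗ₘ F.map g) ≫ (S.tensorIso Y Y').hom =
      (S.tensorIso X X').hom ≫ F.map (f ⊗ₘ g) := by
  simp only [tensorIso, Category.assoc, tensorHom_comp_tensorHom_assoc]
  rw [← S.s_map, ← S.s_map, ← S.map_r, ← tensorHom_comp_tensorHom_assoc,
    Functor.LaxMonoidal.μ_natural_assoc]
  rfl

/-- Along the sections, the tensorator of `F` lies over that of `T`. Together with `unitIso_hom_s`
this reduces each coherence law for `F` to the same law for `T`. -/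
theorem tensorIso_hom_s (X Y : P.FullSubcategory) :
    (S.tensorIso X Y).hom ≫ S.s (X ⊗ Y) = (S.s X ⊗ₘ S.s Y) ≫ μ T _ _ := by
  simp only [tensorIso, Category.assoc]
  rw [S.r_s, map_tensor_p, Functor.Monoidal.μ_δ_assoc, tensorHom_comp_tensorHom_assoc, S.s_map_p,
    S.s_map_p]

theorem unitIso_hom_s : S.unitIso.hom ≫ S.s (𝟙_ _) = ε T := by
  simp only [unitIso, Category.assoc]
  rw [S.r_s]
  change ε T ≫ T.map (𝟙 _) = _
  simp

/-- A functor given by splittings is monoidal. -/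
def coreMonoidal : F.CoreMonoidal where
  εIso := S.unitIso
  μIso := S.tensorIso
  μIso_hom_natural_left {X Y} f X' := by
    have h := S.tensorHom_map_tensorIso f (𝟙 X')
    rwa [CategoryTheory.Functor.map_id, tensorHom_id, tensorHom_id] at h
  μIso_hom_natural_right X' f := by
    have h := S.tensorHom_map_tensorIso (𝟙 X') f
    rwa [CategoryTheory.Functor.map_id, id_tensorHom, id_tensorHom] at h
  associativity X Y Z := by
    have e1 : T.map (α_ X Y Z).hom.hom.f ≫ S.r (X ⊗ Y ⊗ Z) =
        T.map (α_ X.obj.X Y.obj.X Z.obj.X).hom ≫ S.r (X ⊗ Y ⊗ Z) := by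
      -- The associator of the Karoubi envelope is that of `D₀` preceded by the idempotents.
      -- Naturality moves them behind it, where the retraction absorbs them.
      have h : (α_ X Y Z).hom.hom.f =
          (α_ X.obj.X Y.obj.X Z.obj.X).hom ≫ (X ⊗ Y ⊗ Z).obj.p :=
        associator_naturality _ _ _
      rw [h, T.map_comp, Category.assoc, S.map_p_r]
    have e2 : (S.tensorIso X Y).hom ▷ F.obj Z ≫ (S.s (X ⊗ Y) ⊗ₘ S.s Z) =
        ((S.s X ⊗ₘ S.s Y) ⊗ₘ S.s Z) ≫ μ T _ _ ▷ _ := by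
      rw [← tensorHom_id, tensorHom_comp_tensorHom, Category.id_comp, S.tensorIso_hom_s,
        ← tensorHom_id, tensorHom_comp_tensorHom, Category.comp_id]
    have e3 : F.obj X ◁ (S.tensorIso Y Z).hom ≫ (S.s X ⊗ₘ S.s (Y ⊗ Z)) =
        (S.s X ⊗ₘ (S.s Y ⊗ₘ S.s Z)) ≫ _ ◁ μ T _ _ := by
      rw [← id_tensorHom, tensorHom_comp_tensorHom, Category.id_comp, S.tensorIso_hom_s,
        ← id_tensorHom, tensorHom_comp_tensorHom, Category.comp_id]
    have e4 : (S.tensorIso (X ⊗ Y) Z).hom ≫ F.map (α_ X Y Z).hom =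
        (S.s (X ⊗ Y) ⊗ₘ S.s Z) ≫ μ T _ _ ≫
          T.map (α_ X.obj.X Y.obj.X Z.obj.X).hom ≫ S.r (X ⊗ Y ⊗ Z) := by
      simp only [tensorIso, Category.assoc]
      rw [← S.map_r, e1]
    -- With all sections moved to the front and a single retraction left at the end, what remains
    -- between them is the coherence law of `T`.
    have e5 := Functor.LaxMonoidal.associativity T X.obj.X Y.obj.X Z.obj.X
    rw [e4, reassoc_of% e2]
    have e6 : (S.tensorIso X (Y ⊗ Z)).hom =
      (S.s X ⊗ₘ S.s (Y ⊗ Z)) ≫ μ T X.obj.X (Y.obj.X ⊗ Z.obj.X) ≫ S.r (X ⊗ Y ⊗ Z) := rfl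
    rw [e6, reassoc_of% e3, ← associator_naturality_assoc, ← reassoc_of% e5]
    rfl
  left_unitality X := by
    have e1 : T.map (λ_ X).hom.hom.f ≫ S.r X = T.map (λ_ X.obj.X).hom ≫ S.r X := by
      have h : (λ_ X).hom.hom.f = (λ_ X.obj.X).hom ≫ X.obj.p := by
        rw [← leftUnitor_naturality, ← id_tensorHom]
        rfl
      rw [h, T.map_comp, Category.assoc, S.map_p_r]
    have e2 : S.unitIso.hom ▷ F.obj X ≫ (S.s (𝟙_ _) ⊗ₘ S.s X) =
        𝟙_ C₀ ◁ S.s X ≫ ε T ▷ _ := by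
      rw [← tensorHom_id, tensorHom_comp_tensorHom, Category.id_comp, S.unitIso_hom_s,
        ← id_tensorHom, ← tensorHom_id, tensorHom_comp_tensorHom, Category.id_comp,
        Category.comp_id]
    have e4 : (S.tensorIso (𝟙_ _) X).hom ≫ F.map (λ_ X).hom =
        (S.s (𝟙_ _) ⊗ₘ S.s X) ≫ μ T (𝟙_ _) X.obj.X ≫ T.map (λ_ X.obj.X).hom ≫ S.r X := by
      simp only [tensorIso, Category.assoc]
      rw [← S.map_r, e1]
      rfl
    have e5 := Functor.LaxMonoidal.left_unitality T X.obj.X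
    rw [e4, reassoc_of% e2, ← reassoc_of% e5, leftUnitor_naturality_assoc, S.s_r,
      Category.comp_id]
  right_unitality X := by
    have e1 : T.map (ρ_ X).hom.hom.f ≫ S.r X = T.map (ρ_ X.obj.X).hom ≫ S.r X := by
      have h : (ρ_ X).hom.hom.f = (ρ_ X.obj.X).hom ≫ X.obj.p := by
        rw [← rightUnitor_naturality, ← tensorHom_id]
        rfl
      rw [h, T.map_comp, Category.assoc, S.map_p_r]
    have e2 : F.obj X ◁ S.unitIso.hom ≫ (S.s X ⊗ₘ S.s (𝟙_ _)) =
        S.s X ▷ 𝟙_ C₀ ≫ _ ◁ ε T := by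
      rw [← id_tensorHom, tensorHom_comp_tensorHom, Category.id_comp, S.unitIso_hom_s,
        ← id_tensorHom, ← tensorHom_id, tensorHom_comp_tensorHom, Category.id_comp,
        Category.comp_id]
    have e4 : (S.tensorIso X (𝟙_ _)).hom ≫ F.map (ρ_ X).hom =
        (S.s X ⊗ₘ S.s (𝟙_ _)) ≫ μ T X.obj.X (𝟙_ _) ≫ T.map (ρ_ X.obj.X).hom ≫ S.r X := by
      simp only [tensorIso, Category.assoc]
      rw [← S.map_r, e1]
      rfl
    have e5 := Functor.LaxMonoidal.right_unitality T X.obj.X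
    rw [e4, reassoc_of% e2, ← reassoc_of% e5, rightUnitor_naturality_assoc, S.s_r,
      Category.comp_id]

end Monoidal

end KaroubiSplitting

end Splitting

/-- The functor is faithful, so linearity of the inverse can be tested after applying it. There a
map is recovered up to conjugation by counit components, and composition is bilinear. -/
theorem IsRPlusLinear.inverse {C₁ C₂ : Type*} [Category C₁] [Category C₂] [RPlusEnriched C₁]
    [RPlusEnriched C₂] (e : C₁ ≌ C₂) (h : IsRPlusLinear e.functor) :
    IsRPlusLinear e.inverse where
  map_add f g := e.functor.map_injective (by
    rw [h.map_add, e.fun_inv_map, e.fun_inv_map, e.fun_inv_map, RPlusEnriched.add_comp,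
      RPlusEnriched.comp_add])
  map_smul c f := e.functor.map_injective (by
    rw [h.map_smul, e.fun_inv_map, e.fun_inv_map, RPlusEnriched.smul_comp,
      RPlusEnriched.comp_smul])

variable {G H K : FdHilb}

/-! ### The copyable basis of a classical structure -/

/-- A commuting family of symmetric operators has an orthonormal basis of joint eigenvectors. -/
theorem exists_joint_eigenbasis {n V : Type} [NormedAddCommGroup V] [InnerProductSpace ℂ V]
    [FiniteDimensional ℂ V] (T : n → V →ₗ[ℂ] V) (hT : ∀ i, (T i).IsSymmetric)
    (hC : ∀ i j, Commute (T i) (T j)) :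
    ∃ (κ : Type) (_ : Fintype κ) (b : OrthonormalBasis κ ℂ V) (χ : κ → n → ℂ),
      ∀ k i, T i (b k) = χ k i • b k := by
  classical
  -- The joint eigenspaces, indexed by all families of eigenvalues `n → ℂ`, form an orthogonal
  -- decomposition of `V`; the basis collects orthonormal bases of them.
  have hI := LinearMap.IsSymmetric.directSum_isInternal_of_pairwise_commute hT
    (fun i j _ => hC i j)
  let v := fun α : n → ℂ =>
    stdOrthonormalBasis ℂ (⨅ j, Module.End.eigenspace (T j) (α j) : Submodule ℂ V)
  let B := hI.collectedBasis fun α => (v α).toBasis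
  have hB : Orthonormal ℂ B := DirectSum.IsInternal.collectedBasis_orthonormal
    (LinearMap.IsSymmetric.orthogonalFamily_iInf_eigenspaces hT) hI
    fun α => by simp
  -- The index type runs over all functions `n → ℂ`, but almost all joint eigenspaces vanish: it
  -- indexes a basis of a finite-dimensional space, hence is finite.
  have hfin := Module.Finite.finite_basis B
  have := Fintype.ofFinite (Σ α : n → ℂ,
    Fin (Module.finrank ℂ (⨅ j, Module.End.eigenspace (T j) (α j) : Submodule ℂ V)))
  refine ⟨_, this, B.toOrthonormalBasis hB, fun k => k.1, fun k i => ?_⟩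
  have h := hI.collectedBasis_mem (fun α => (v α).toBasis) k
  rw [Submodule.mem_iInf] at h
  rw [Module.Basis.coe_toOrthonormalBasis]
  exact Module.End.mem_eigenspace_iff.mp (h i)

namespace ClassicalStructure

/-- The left multiplication by a vector, as a linear map in the vector. -/
def mulLeft (Z : ClassicalStructure G) : G →ₗ[ℂ] Op G := (tm G G).compr₂ Z.mul

theorem mulLeft_apply (Z : ClassicalStructure G) (x y : G) :
    Z.mulLeft x y = Z.mul (x ⊗ᵗ y) := rfl

theorem mulLeft_mul (Z : ClassicalStructure G) (x y : G) :
    Z.mulLeft (Z.mul (x ⊗ᵗ y)) = Z.mulLeft x ∘ₗ Z.mulLeft y :=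
  LinearMap.ext fun z => Z.mul_assoc x y z

theorem mulLeft_commute (Z : ClassicalStructure G) (x y : G) :
    Commute (Z.mulLeft x) (Z.mulLeft y) := by
  change Z.mulLeft x ∘ₗ Z.mulLeft y = Z.mulLeft y ∘ₗ Z.mulLeft x
  rw [← mulLeft_mul, ← mulLeft_mul, Z.mul_comm]

/-- This is the adjoint of the Frobenius law in the form `comul_mul`, which says that
comultiplication commutes with left multiplication on the first factor. Taking `y` to be the unit
shows that the adjoint of a left multiplication is a left multiplication. -/
theorem dag_mulLeft_mul (Z : ClassicalStructure G) (x y z : G) :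
    dag (Z.mulLeft x) (Z.mul (y ⊗ᵗ z)) = Z.mul (dag (Z.mulLeft x) y ⊗ᵗ z) := by
  have h : Z.comul ∘ₗ Z.mulLeft x = map (Z.mulLeft x) LinearMap.id ∘ₗ Z.comul :=
    LinearMap.ext fun y => Z.comul_mul x y
  have h2 := congrArg dag h
  rw [dag_comp, dag_comp, dag_map, comul, dag_dag, dag_id] at h2
  exact LinearMap.congr_fun h2 (y ⊗ᵗ z)

/-- The adjoint of a left multiplication is a left multiplication. -/
theorem dag_mulLeft (Z : ClassicalStructure G) (x : G) :
    dag (Z.mulLeft x) = Z.mulLeft (dag (Z.mulLeft x) Z.unit) := by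
  refine LinearMap.ext fun z => ?_
  rw [mulLeft_apply, ← dag_mulLeft_mul, Z.unit_mul]

/-- Every classical structure copies, up to scalars, the vectors of an orthonormal basis. -/
theorem exists_basis (Z : ClassicalStructure G) :
    ∃ (κ : Type) (_ : Fintype κ) (_ : DecidableEq κ) (b : OrthonormalBasis κ ℂ G) (c : κ → ℂ),
      ∀ i j, Z.mul (b i ⊗ᵗ b j) = if i = j then c i • b i else 0 := by
  classical
  -- Left multiplications are normal but need not be symmetric. Adding the adjoint gives symmetric
  -- operators, which still commute because they are again left multiplications.
  let T : G → Op G := fun x => Z.mulLeft x + dag (Z.mulLeft x)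
  have hT : ∀ x, (T x).IsSymmetric := fun x y z => by
    simp only [T, LinearMap.add_apply, inner_add_left, inner_add_right, dag_inner_left,
      dag_inner_right]
    ring
  have hC : ∀ x y, Commute (T x) (T y) := fun x y => by
    simp only [T]
    rw [Z.dag_mulLeft x, Z.dag_mulLeft y, ← map_add, ← map_add]
    exact Z.mulLeft_commute _ _
  obtain ⟨κ, _, b, χ, h⟩ := exists_joint_eigenbasis T hT hC
  -- Since `dag` is conjugate-linear, `-i • T (i • x)` is the left multiplication minus its adjoint.
  -- Averaging with `T x` removes the adjoint, so the joint eigenvectors of the `T x` are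
  -- eigenvectors of every left multiplication.
  have hL : ∀ x, Z.mulLeft x = (1 / 2 : ℂ) • (T x - Complex.I • T (Complex.I • x)) := fun x => by
    have h1 : T (Complex.I • x) =
        Complex.I • Z.mulLeft x + star Complex.I • dag (Z.mulLeft x) := by
      simp only [T, map_smul Z.mulLeft, dag_smul]
    rw [h1, smul_add, smul_smul, smul_smul, Complex.star_def, Complex.conj_I, mul_neg,
      Complex.I_mul_I]
    simp only [T]
    module
  have hb : ∀ x k, Z.mul (x ⊗ᵗ b k) =
      ((1 / 2 : ℂ) * (χ k x - Complex.I * χ k (Complex.I • x))) • b k := fun x k => by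
    rw [← mulLeft_apply, hL]
    simp only [LinearMap.smul_apply, LinearMap.sub_apply, h, smul_smul, ← sub_smul]
  refine ⟨κ, inferInstance, inferInstance, b,
    fun i => (1 / 2 : ℂ) * (χ i (b i) - Complex.I * χ i (Complex.I • b i)), fun i j => ?_⟩
  split_ifs with hij
  · subst hij
    exact hb _ _
  -- For `i ≠ j` the product is a multiple of `b j`, and by commutativity also a multiple of `b i`.
  -- Pairing with `b j` shows that it vanishes.
  · have h1 := hb (b i) j
    have h2 := hb (b j) i
    rw [Z.mul_comm, h1] at h2
    have h3 := congrArg (inner ℂ (b j)) h2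
    rw [inner_smul_right, inner_smul_right, b.inner_eq_ite, b.inner_eq_ite, if_pos rfl,
      if_neg (Ne.symm hij), mul_zero, mul_one] at h3
    rw [h1, h3, zero_smul]

end ClassicalStructure

/-! ### Completely positive maps between quantum systems -/

/-- Linear maps sandwiched between a multiplication and a comultiplication arise by joining
copies of linear maps by a bridge, in a way which keeps different maps apart. -/
theorem exists_contract_eq (Z : ClassicalStructure H) (W : ClassicalStructure K) {ι : Type}
    [Fintype ι] [DecidableEq ι] (k : ι → H →ₗ[ℂ] K) :
    ∃ (G : FdHilb) (V : ClassicalStructure G) (a : ι → H →ₗ[ℂ] G ⊗ʰ K), ∀ i j,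
      contract V (a i) (a j) = if i = j then W.comul ∘ₗ k i ∘ₗ Z.mul else 0 := by
  obtain ⟨κ, _, _, b, c, hb⟩ := Z.exists_basis
  obtain ⟨κ', _, _, w, d, hw⟩ := W.exists_basis
  -- The bridge is bilinear, without conjugation, so a coefficient produced by two copies of one map
  -- is a square, not a squared modulus. Complex square roots therefore realise arbitrary
  -- coefficients.
  have hsq : ∀ x : ℂ, ∃ y, y * y = x := fun x => by
    obtain ⟨y, hy⟩ := IsAlgClosed.exists_pow_nat_eq x two_pos
    exact ⟨y, by rw [← hy, sq]⟩
  choose rt hrt using hsq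
  -- The coefficient of `w y ⊗ w y` in the image of `b z ⊗ b z` under `W.comul ∘ₗ k i ∘ₗ Z.mul`.
  let q : ι → κ → κ' → ℂ := fun i z y => c z * (inner ℂ (w y) (k i (b z)) * star (d y))
  -- The bridged system has one basis vector per label: Kraus index, input basis vector and output
  -- basis vector.
  obtain ⟨G, V, e, hV⟩ : ∃ (G : FdHilb) (V : ClassicalStructure G) (e : ι × κ × κ' → G),
      ∀ p q, V.bridge (e p ⊗ᵗ e q) = if p = q then 1 else 0 :=
    ⟨_, _, _, ClassicalStructure.ofBasis_bridge (stdB (ι × κ × κ'))⟩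
  let a : ι → H →ₗ[ℂ] G ⊗ʰ K := fun i =>
    b.toBasis.constr ℂ fun z => ∑ y, rt (q i z y) • (e (i, z, y) ⊗ᵗ w y)
  have ha : ∀ i z, a i (b z) = ∑ y, rt (q i z y) • (e (i, z, y) ⊗ᵗ w y) := fun i z => by
    have := b.toBasis.constr_basis ℂ (fun z => ∑ y, rt (q i z y) • (e (i, z, y) ⊗ᵗ w y)) z
    rwa [b.coe_toBasis] at this
  -- The adjoint of a multiplication diagonal in `w` copies `w`, with conjugated scalars.
  have hcw : ∀ y, W.comul (w y) = star (d y) • (w y ⊗ᵗ w y) := fun y => by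
    refine vec_ext (onb_ext (prodB w w) fun p => ?_)
    rw [prodB_apply]
    simp only [innerₛₗ_apply_apply, ClassicalStructure.comul, dag_inner_left, hw,
      inner_smul_left, inner_tm, w.inner_eq_ite]
    by_cases h1 : p.1 = p.2
    · rw [if_pos h1, ← h1, inner_smul_right, w.inner_eq_ite]
      by_cases h2 : y = p.1 <;> simp [h2]
    · rw [if_neg h1, inner_zero_right]
      by_cases h2 : y = p.1
      · rw [if_neg (fun h3 => h1 (h2.symm.trans h3))]; simp
      · rw [if_neg h2]; simp
  refine ⟨_, V, a, fun i j => onb_ext (prodB b b) fun p => ?_⟩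
  obtain ⟨z, z'⟩ := p
  rw [prodB_apply]
  -- The bridge keeps only equal labels: this forces `i = j` and `z = z'`, and leaves the diagonal
  -- terms `y = y'` with coefficient `rt q * rt q = q`.
  have hl : contract V (a i) (a j) (b z ⊗ᵗ b z') = ∑ y, ∑ y',
      (rt (q i z y) * rt (q j z' y')) •
        ((if (i, z, y) = (j, z', y') then (1 : ℂ) else 0) • (w y ⊗ᵗ w y')) := by
    simp only [contract, LinearMap.comp_apply, map_tm, ha, map_sum, LinearMap.sum_apply,
      map_smul, LinearMap.smul_apply, swapMid_tm, applyFst_tm, hV, Finset.smul_sum, smul_smul]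
    rw [Finset.sum_comm]
    refine Finset.sum_congr rfl fun y _ => Finset.sum_congr rfl fun y' _ => ?_
    congr 1
    ring
  rw [hl]
  by_cases hij : i = j
  · subst hij
    rw [if_pos rfl, LinearMap.comp_apply, LinearMap.comp_apply, hb]
    by_cases hz : z = z'
    · subst hz
      rw [if_pos rfl, map_smul, map_smul, ← w.sum_repr' (k i (b z)), map_sum, Finset.smul_sum]
      refine Finset.sum_congr rfl fun y _ => ?_
      rw [Finset.sum_eq_single y (fun y' _ h => by simp [Ne.symm h]) (by simp), if_pos rfl,
        one_smul, hrt, map_smul, hcw, smul_smul, smul_smul, mul_assoc]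
    · simp [hz]
  · simp [hij]

/-- A completely positive map between the quantum systems encoded by classical structures is a
map of density hypercubes. -/
theorem IsCP.isDD_lift (Z : ClassicalStructure H) (W : ClassicalStructure K)
    {Φ : Op H →ₗ[ℂ] Op K} (h : IsCP Φ) : IsDD (doubled W.comul ∘ₗ Φ ∘ₗ doubled Z.mul) := by
  classical
  obtain ⟨ι, _, k, rfl⟩ := (isCP_iff _).mp h
  obtain ⟨G, V, a, ha⟩ := exists_contract_eq Z W k
  refine (isDD_iff _).mpr ⟨ι, inferInstance, G, V, a, ?_⟩
  -- A map of density hypercubes sums over pairs of Kraus indices; the labels make the off-diagonal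
  -- pairs vanish, so only the single sum defining `Φ` survives.
  simp only [ha, Fintype.sum_prod_type]
  refine LinearMap.ext fun ρ => ?_
  simp only [LinearMap.comp_apply, LinearMap.sum_apply, map_sum]
  refine Finset.sum_congr rfl fun i _ => ?_
  rw [Finset.sum_eq_single i (fun j _ hj => by rw [if_neg hj.symm, doubled_zero]; rfl) (by simp),
    if_pos rfl, doubled_comp, doubled_comp]
  rfl

theorem ClassicalStructure.doubled_mul_comul (Z : ClassicalStructure G) :
    doubled Z.mul ∘ₗ doubled Z.comul = LinearMap.id := by
  rw [← doubled_comp, comul, Z.special, doubled_id]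

/-- By speciality the comultiplication is an isometry, and conjugation by an isometry preserves the
trace by cyclicity. -/
theorem ClassicalStructure.trace_doubled_comul (Z : ClassicalStructure G) (ρ : Op G) :
    LinearMap.trace ℂ (G ⊗ʰ G :) (doubled Z.comul ρ) = LinearMap.trace ℂ G ρ := by
  have h : (ρ ∘ₗ dag Z.comul) ∘ₗ Z.comul = ρ := by
    rw [LinearMap.comp_assoc, comul, dag_dag, Z.special, LinearMap.comp_id]
  rw [doubled_apply, LinearMap.trace_comp_comm', h]

/-- The classical structure of a quantum system. -/
def QuantumSubcat.classicalStructure (X : QuantumSubcat) : ClassicalStructure X.obj.X.toHilb :=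
  X.property.choose

theorem QuantumSubcat.p_eq (X : QuantumSubcat) : X.obj.p = hyperDecoherence X.classicalStructure :=
  X.property.choose_spec

/-! ### The equivalence -/

/-- The inverse carries the structure of a right adjoint to a monoidal functor, for which the unit
and the counit are monoidal transformations. -/
theorem isMonoidal_inverseMonoidal {C₁ C₂ : Type*} [Category C₁] [Category C₂]
    [MonoidalCategory C₁] [MonoidalCategory C₂] (e : C₁ ≌ C₂) [e.functor.Monoidal] :
    letI := e.inverseMonoidal
    e.IsMonoidal :=
  letI := e.toAdjunction.rightAdjointLaxMonoidal
  (inferInstance : e.toAdjunction.IsMonoidal)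

open Idempotents

instance : DD.toCPM.Monoidal := Monoidal.fromInducedMonoidal DD.toCPM DD.inducingData

theorem QuantumSubcat.p_map (X : QuantumSubcat) :
    X.obj.p.map = doubled X.classicalStructure.comul ∘ₗ doubled X.classicalStructure.mul := by
  rw [X.p_eq, ← doubled_comp]
  rfl

/-- Morphisms of the Karoubi envelope absorb the idempotent of their source, here in its split form.
-/
theorem QuantumSubcat.map_p_comp {X Y : QuantumSubcat} (f : X ⟶ Y) :
    f.hom.f.map ∘ₗ doubled X.classicalStructure.comul ∘ₗ doubled X.classicalStructure.mul =
      f.hom.f.map := by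
  rw [← X.p_map, ← DD.comp_map, Karoubi.p_comp]

/-- The functor sending `(DD(H), hyp)` to the quantum system `H`. -/
def toQuantum : QuantumSubcat ⥤ CPM where
  obj X := CPM.of X.obj.X.toHilb
  map {X Y} f := CPM.pure X.classicalStructure.comul ≫ f.hom.f.toCP ≫
    CPM.pure Y.classicalStructure.mul
  map_id X := CPM.hom_ext (by
    have h := X.classicalStructure.doubled_mul_comul
    -- The identity of an object of the Karoubi envelope is its idempotent.
    change (doubled _ ∘ₗ X.obj.p.map) ∘ₗ doubled _ = LinearMap.id
    rw [X.p_map, ← LinearMap.comp_assoc, h, LinearMap.id_comp, h])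
  map_comp {X Y Z} f g := CPM.hom_ext (by
    change (doubled _ ∘ₗ g.hom.f.map ∘ₗ f.hom.f.map) ∘ₗ doubled _ =
      ((doubled _ ∘ₗ g.hom.f.map) ∘ₗ doubled _) ∘ₗ (doubled _ ∘ₗ f.hom.f.map) ∘ₗ doubled _
    -- The composite of the two images has the idempotent of `Y` in the middle; inserting it in
    -- front of `g` on the left matches the two sides.
    conv_lhs => rw [← QuantumSubcat.map_p_comp g]
    simp only [LinearMap.comp_assoc])

/-- The presentation of `toQuantum` by splittings of the hyper-decoherence maps. -/
def quantumSplitting : KaroubiSplitting DD.toCPM toQuantum where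
  s X := CPM.pure (QuantumSubcat.classicalStructure X).comul
  r X := CPM.pure (QuantumSubcat.classicalStructure X).mul
  s_r X := CPM.hom_ext (QuantumSubcat.classicalStructure X).doubled_mul_comul
  r_s X := CPM.hom_ext (QuantumSubcat.p_map X).symm
  map_eq f := rfl

instance : toQuantum.Faithful := quantumSplitting.faithful

/-- The map to be lifted, retraction then `g` then section, is exactly the one that `IsCP.isDD_lift`
shows to be a map of density hypercubes. -/
instance : toQuantum.Full := quantumSplitting.full fun {X Y} g =>
  ⟨⟨_, g.isCP.isDD_lift (QuantumSubcat.classicalStructure X)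
    (QuantumSubcat.classicalStructure Y)⟩, rfl⟩

instance : toQuantum.EssSurj where
  mem_essImage Y := ⟨quantumObj Y.toHilb
    (ClassicalStructure.ofBasis (stdOrthonormalBasis ℂ Y.toHilb)), ⟨Iso.refl _⟩⟩

instance : toQuantum.IsEquivalence where

theorem toQuantum_isRPlusLinear : IsRPlusLinear toQuantum where
  map_add f g := CPM.hom_ext (by
    change doubled _ ∘ₗ (f.hom.f.map + g.hom.f.map) ∘ₗ doubled _ =
      (toQuantum.map f).map + (toQuantum.map g).map
    rw [LinearMap.add_comp, LinearMap.comp_add]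
    rfl)
  map_smul c f := CPM.hom_ext (by
    change doubled _ ∘ₗ (c • f.hom.f.map) ∘ₗ doubled _ = c • (toQuantum.map f).map
    rw [nnreal_smul, nnreal_smul, LinearMap.smul_comp, LinearMap.comp_smul]
    rfl)

/-! ### Discarding maps, normalisation and trace preservation -/

theorem discardQ_map (X : QuantumSubcat) (ρ : Op (X.obj.X.toHilb ⊗ʰ X.obj.X.toHilb)) :
    (discardQ X).hom.f.map ρ =
      LinearMap.trace ℂ X.obj.X.toHilb (doubled X.classicalStructure.mul ρ) •
        (LinearMap.id : Op (FdHilb.unit ⊗ʰ FdHilb.unit)) := by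
  change LinearMap.trace ℂ (X.obj.X.toHilb ⊗ʰ X.obj.X.toHilb :) (X.obj.p.map ρ) •
    (LinearMap.id : Op (FdHilb.unit ⊗ʰ FdHilb.unit)) = _
  rw [X.p_map, LinearMap.comp_apply, ClassicalStructure.trace_doubled_comul]

theorem isNormalised_iff {X Y : QuantumSubcat} (f : X ⟶ Y) :
    IsNormalised f ↔ ∀ ρ, LinearMap.trace ℂ Y.obj.X.toHilb
        (doubled Y.classicalStructure.mul (f.hom.f.map ρ)) =
      LinearMap.trace ℂ X.obj.X.toHilb (doubled X.classicalStructure.mul ρ) := by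
  -- Discarding takes values in multiples of the identity of `ℂ ⊗ ℂ`; the scalar is recovered by
  -- evaluating at `one ⊗ one`.
  have h0 : ∀ c d : ℂ, c • (LinearMap.id : Op (FdHilb.unit ⊗ʰ FdHilb.unit)) =
      d • LinearMap.id → c = d := fun c d h => by
    have h1 := congrArg (fun t : Op (FdHilb.unit ⊗ʰ FdHilb.unit) => lid FdHilb.unit (t (one ⊗ᵗ one))) h
    have h2 := congrArg scal h1
    simpa using h2
  constructor
  · intro h ρ
    have h1 := congrArg (fun t => t.hom.f.map ρ) h
    refine h0 _ _ ?_
    rw [← discardQ_map, ← discardQ_map]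
    exact h1
  · intro h
    refine ObjectProperty.hom_ext _ (Karoubi.hom_ext _ _ (DD.hom_ext (LinearMap.ext fun ρ => ?_)))
    change (discardQ Y).hom.f.map (f.hom.f.map ρ) = _
    rw [discardQ_map, discardQ_map, h]

/-- Trace preservation evaluated at `μ̂ ρ` gives normalisation at `ρ`, because `f` absorbs `δ̂ ∘
μ̂`. Normalisation evaluated at `δ̂ ρ` gives trace preservation at `ρ`, because `μ̂ ∘ δ̂ = id`. -/
theorem isTracePreserving_toQuantum_iff {X Y : QuantumSubcat} (f : X ⟶ Y) :
    CPM.IsTracePreserving (toQuantum.map f) ↔ IsNormalised f := by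
  rw [isNormalised_iff]
  constructor
  · intro h ρ
    have h1 := h (doubled X.classicalStructure.mul ρ)
    have h2 := LinearMap.congr_fun (QuantumSubcat.map_p_comp f) ρ
    rw [← h2]
    exact h1
  · intro h ρ
    refine (h (doubled X.classicalStructure.comul ρ)).trans ?_
    exact congrArg (LinearMap.trace ℂ X.obj.X.toHilb)
      (LinearMap.congr_fun X.classicalStructure.doubled_mul_comul ρ)

/-- The argument uses the given `Z` directly: the structure chosen by `classicalStructure` is only
known to induce the same hyper-decoherence map. -/
theorem discardQ_quantumObj (H : FdHilb) (Z : ClassicalStructure H) :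
    (discardQ (quantumObj H Z)).hom.f.toCP = treeOnBridge Z := by
  -- The target of discarding is `ℂ ⊗ ℂ` rather than `ℂ`. The inverse unitor between them is
  -- unitary, so its doubling preserves the identity operator.
  have h1 : doubled (tm FdHilb.unit FdHilb.unit one) LinearMap.id = LinearMap.id := by
    have h2 : dag (lid FdHilb.unit) = tm FdHilb.unit FdHilb.unit one :=
      LinearMap.ext dag_lid_apply
    rw [doubled_apply, LinearMap.id_comp, ← h2, dag_dag, h2]
    exact hext fun c x => by
      rw [LinearMap.comp_apply, lid_tm, eq_scal_smul c]
      simp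
  have h3 : ∀ ρ : Op (H ⊗ʰ H),
      LinearMap.trace ℂ (H ⊗ʰ H :) (doubled (Z.comul ∘ₗ Z.mul) ρ) •
          (LinearMap.id : Op (FdHilb.unit ⊗ʰ FdHilb.unit)) =
        doubled (tm FdHilb.unit FdHilb.unit one)
          (LinearMap.trace ℂ H (doubled Z.mul ρ) • LinearMap.id) := fun ρ => by
    rw [map_smul, h1, doubled_comp, LinearMap.comp_apply, ClassicalStructure.trace_doubled_comul]
  exact CPM.hom_ext (LinearMap.ext h3)

end Hyp

end

/-! ### The main theorem -/

theorem mainTheorem1 :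
    (∃ (e : Hyp.QuantumSubcat ≌ Hyp.CPM) (_ : e.functor.Monoidal) (_ : e.inverse.Monoidal),
      e.IsMonoidal ∧ Hyp.IsRPlusLinear e.functor ∧ Hyp.IsRPlusLinear e.inverse ∧
      ∀ {X Y : Hyp.QuantumSubcat} (f : X ⟶ Y),
        Hyp.CPM.IsTracePreserving (e.functor.map f) ↔ Hyp.IsNormalised f) ∧
    ∀ (H : FdHilb) (Z : Hyp.ClassicalStructure H),
      (Hyp.discardQ (Hyp.quantumObj H Z)).hom.f.toCP = Hyp.treeOnBridge Z := by
  refine ⟨?_, Hyp.discardQ_quantumObj⟩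
  let e : Hyp.QuantumSubcat ≌ Hyp.CPM := Hyp.toQuantum.asEquivalence
  -- The functor of `e` is `toQuantum` by definition, so the monoidal structure given by the
  -- splittings applies to it; the inverse receives its structure by adjunction.
  let _ : e.functor.Monoidal := Hyp.quantumSplitting.coreMonoidal.toMonoidal
  let _ : e.inverse.Monoidal := e.inverseMonoidal
  exact ⟨e, inferInstance, inferInstance, Hyp.isMonoidal_inverseMonoidal e, Hyp.toQuantum_isRPlusLinear,
    Hyp.toQuantum_isRPlusLinear.inverse (e := e), Hyp.isTracePreserving_toQuantum_iff⟩
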